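/- Let $K$ be a field, let $m,n\ge 0$, let $S=K[X_1,\dots,X_m,Y_1,\dots,Y_n]$, and let $R=K[\Delta]=S/I_\Delta$ be the Stanley--Reisner ring of a simplicial complex $\Delta$ on the vertex set $\{v_1,\dots,v_m\}\cup\{w_1,\dots,w_n\}$ (not every vertex need be a face), where $v_i$ corresponds to $X_i$ and $w_j$ to $Y_j$. Let $x_i,y_j$ be the residue classes of the variables and put $P=(y_1,\dots,y_n)$. Give $R$ the bigrading with $\deg x_i=(1,0)$, $\deg y_j=(0,1)$, let $R_0$ be the subring of elements of $y$-degree $0$, and let $H^i_P(R)$, the $i$-th cohomology of the Čech complex of $R$ with respect to $y_1,\dots,y_n$, carry the induced $\mathbb Z\times\mathbb Z$-bigrading. For $j\in\mathbb Z$ let $H^i_P(R)_j=\bigoplus_k H^i_P(R)_{(k,j)}$, an $R_0$-module. Fix $i\ge 0$. Then every $H^i_P(R)_{(k,j)}$ is a finite-dimensional $K$-vector space and every $H^i_P(R)_j$ is a finitely generated $R_0$-module. There is an integer $j_0$ such that the Krull dimension of the $R_0$-module $H^i_P(R)_j$ is the same for all $j\le j_0$ (the zero module has dimension $-\infty$).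 More precisely, there is a polynomial $Q(s)=\sum_{r=0}^m B_r s^r$ whose coefficients $B_r\in\mathbb Q[j]$ are polynomials in $j$ of degree at most $n-1$ (all zero if $n=0$) such that, with $Q_j(s)=\sum_{r=0}^m B_r(j)s^r$, $$\sum_{k\ge 0}\dim_K H^i_P(R)_{(k,j)}\,s^k=\frac{Q_j(s)}{(1-s)^m}\qquad\text{for all } j<0,$$ and the integer $j_0$ above can be chosen negative and such that the following holds. If $Q=0$, then $\dim H^i_P(R)_j=-\infty$ for all $j\le j_0$. If $Q\ne 0$ and $c$ is the order of vanishing of $Q$ at $s=1$ (as a polynomial in $s$ over $\mathbb Q[j]$), then $c\le m$, and for all $j\le j_0$ the polynomial $Q_j$ is nonzero, its order of vanishing at $s=1$ is $c$, and $\dim H^i_P(R)_j=m-c$. -/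

import Mathlib

open Polynomial

namespace MonomialTame

noncomputable section

/-- The Stanley–Reisner ideal of a simplicial complex: it is generated by the squarefree monomials
`∏ v ∈ F, X v` of the nonfaces `F`. (In `PreAbstractSimplicialComplex` only nonempty faces are
recorded, the empty face is implicit, and a vertex need not be a face.) -/
def stanleyReisnerIdeal (K : Type*) [Field K] {σ : Type*} (Δ : PreAbstractSimplicialComplex σ) :
    Ideal (MvPolynomial σ K) :=
  Ideal.span {u | ∃ F : Finset σ, F.Nonempty ∧ F ∉ Δ ∧ u = ∏ v ∈ F, MvPolynomial.X v}

/-- The Stanley–Reisner ring `K[Δ]`. -/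
abbrev StanleyReisnerRing (K : Type*) [Field K] {σ : Type*} (Δ : PreAbstractSimplicialComplex σ) :
    Type _ :=
  MvPolynomial σ K ⧸ stanleyReisnerIdeal K Δ

/-- The bidegrees of the variables: the variables `x i` (indexed by `Fin m`) have bidegree `(1, 0)`,
the variables `y j` (indexed by `Fin n`) have bidegree `(0, 1)`. -/
def bidegree (m n : ℕ) : Fin m ⊕ Fin n → ℕ × ℕ :=
  Sum.elim (fun _ => (1, 0)) (fun _ => (0, 1))

/-- The `y`-degrees of the variables (the second components of the bidegrees). -/
def yDegree (m n : ℕ) : Fin m ⊕ Fin n → ℕ :=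
  fun v => (bidegree m n v).2

section

variable (K : Type*) [Field K] {m n : ℕ} (Δ : PreAbstractSimplicialComplex (Fin m ⊕ Fin n))

/-- The bigraded piece `R_(p,q)` of `R = K[Δ]`. -/
def ringPiece (p q : ℕ) : Submodule K (StanleyReisnerRing K Δ) :=
  (MvPolynomial.weightedHomogeneousSubmodule K (bidegree m n) (p, q)).map
    (Ideal.Quotient.mkₐ K (stanleyReisnerIdeal K Δ)).toLinearMap

/-- The subring of `K[x, y]` of all polynomials of `y`-degree `0`. -/
def polyZero (K : Type*) [Field K] (m n : ℕ) : Subalgebra K (MvPolynomial (Fin m ⊕ Fin n) K) where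
  carrier := {f | MvPolynomial.IsWeightedHomogeneous (yDegree m n) f 0}
  mul_mem' ha hb := by simpa using ha.mul hb
  add_mem' ha hb := ha.add hb
  algebraMap_mem' c := MvPolynomial.isWeightedHomogeneous_C _ c

/-- The subring `R_0` of `R = K[Δ]` of all elements of `y`-degree `0`. -/
def ringZero : Subalgebra K (StanleyReisnerRing K Δ) :=
  (polyZero K m n).map (Ideal.Quotient.mkₐ K (stanleyReisnerIdeal K Δ))

/-- The residue class `y j` in `K[Δ]` of the `j`-th variable of bidegree `(0, 1)`. -/
def yVar (j : Fin n) : StanleyReisnerRing K Δ :=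
  Ideal.Quotient.mkₐ K (stanleyReisnerIdeal K Δ) (MvPolynomial.X (Sum.inr j))

/-- The product `y^F` of the `y j` with `j ∈ F`. -/
def yProd (F : Finset (Fin n)) : StanleyReisnerRing K Δ :=
  ∏ j ∈ F, yVar K Δ j

/-- The localization of `R` at the powers of `y^F`. -/
abbrev CechLoc (F : Finset (Fin n)) : Type _ :=
  Localization.Away (yProd K Δ F)

lemma isUnit_yProd {F F' : Finset (Fin n)} (h : F ⊆ F') :
    IsUnit (algebraMap (StanleyReisnerRing K Δ) (CechLoc K Δ F') (yProd K Δ F)) :=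
  isUnit_of_dvd_unit
    (map_dvd (algebraMap (StanleyReisnerRing K Δ) (CechLoc K Δ F'))
      (Finset.prod_dvd_prod_of_subset F F' (yVar K Δ) h))
    (IsLocalization.Away.algebraMap_isUnit (yProd K Δ F'))

/-- The natural map from the localization at `y^F` to the one at `y^F'`, where `F ⊆ F'`. -/
def cechMap {F F' : Finset (Fin n)} (h : F ⊆ F') :
    CechLoc K Δ F →ₐ[StanleyReisnerRing K Δ] CechLoc K Δ F' :=
  IsLocalization.Away.liftAlgHom (yProd K Δ F)
    (f := Algebra.ofId (StanleyReisnerRing K Δ) (CechLoc K Δ F')) (isUnit_yProd K Δ h)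

/-- The module `C^t` of the Čech complex of `R` with respect to `y 1, …, y n`: the direct sum of
the localizations at `y^F`, over all `F` with `t` elements. -/
abbrev CechCochain (t : ℕ) : Type _ :=
  (F : {F : Finset (Fin n) // F.card = t}) → CechLoc K Δ F.1

/-- The differential `C^t → C^(t+1)` of the Čech complex: its component from `F' \ {j}` to `F'` is
`(-1)^s` times the natural map, where `s` is the number of elements of `F'` that precede `j`. -/
def cechD (t : ℕ) : CechCochain K Δ t →ₗ[StanleyReisnerRing K Δ] CechCochain K Δ (t + 1) :=
  LinearMap.pi fun F' => ∑ j : {j : Fin n // j ∈ F'.1},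
    (-1 : ℤ) ^ (F'.1.filter (· < j.1)).card •
      ((cechMap K Δ (Finset.erase_subset j.1 F'.1)).toLinearMap ∘ₗ
        LinearMap.proj (⟨F'.1.erase j.1, by
          rw [Finset.card_erase_of_mem j.2, F'.2, Nat.add_sub_cancel]⟩ :
            {F : Finset (Fin n) // F.card = t}))

/-- The coboundaries in `C^i`: zero for `i = 0`, otherwise the image of `C^(i-1)`. -/
def coboundaries : (i : ℕ) → Submodule (StanleyReisnerRing K Δ) (CechCochain K Δ i)
  | 0 => ⊥
  | t + 1 => LinearMap.range (cechD K Δ t)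

/-- The local cohomology module `H^i_P(R)` of `R = K[Δ]` with respect to `P = (y 1, …, y n)`,
as the `i`-th cohomology of the Čech complex: cocycles modulo coboundaries. -/
def LocalCohomology (i : ℕ) : Type _ :=
  LinearMap.ker (cechD K Δ i) ⧸ (coboundaries K Δ i).submoduleOf (LinearMap.ker (cechD K Δ i))

instance (i : ℕ) : AddCommGroup (LocalCohomology K Δ i) :=
  inferInstanceAs (AddCommGroup (LinearMap.ker (cechD K Δ i) ⧸
    (coboundaries K Δ i).submoduleOf (LinearMap.ker (cechD K Δ i))))

instance (i : ℕ) : Module (StanleyReisnerRing K Δ) (LocalCohomology K Δ i) :=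
  inferInstanceAs (Module (StanleyReisnerRing K Δ) (LinearMap.ker (cechD K Δ i) ⧸
    (coboundaries K Δ i).submoduleOf (LinearMap.ker (cechD K Δ i))))

instance (i : ℕ) : Module K (LocalCohomology K Δ i) :=
  inferInstanceAs (Module K (LinearMap.ker (cechD K Δ i) ⧸
    (coboundaries K Δ i).submoduleOf (LinearMap.ker (cechD K Δ i))))

instance (i : ℕ) : IsScalarTower K (StanleyReisnerRing K Δ) (LocalCohomology K Δ i) :=
  inferInstanceAs (IsScalarTower K (StanleyReisnerRing K Δ) (LinearMap.ker (cechD K Δ i) ⧸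
    (coboundaries K Δ i).submoduleOf (LinearMap.ker (cechD K Δ i))))

/-- The class in `H^i_P(R)` of a cocycle. -/
def cohomologyClass (i : ℕ) :
    LinearMap.ker (cechD K Δ i) →ₗ[StanleyReisnerRing K Δ] LocalCohomology K Δ i :=
  ((coboundaries K Δ i).submoduleOf (LinearMap.ker (cechD K Δ i))).mkQ

/-- The bigraded piece of bidegree `(k, j)` of the localization at `y^F`: it consists of the
fractions `r / (y^F)^l` with `r` bihomogeneous and `deg r - l * deg (y^F) = (k, j)`. -/
def locPiece (F : Finset (Fin n)) (k j : ℤ) : Submodule K (CechLoc K Δ F) :=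
  Submodule.span K {z | ∃ (p q l : ℕ), ∃ r ∈ ringPiece K Δ p q,
    (p : ℤ) = k ∧ (q : ℤ) - l * F.card = j ∧
      z = Localization.mk r ⟨yProd K Δ F ^ l, pow_mem (Submonoid.mem_powers _) l⟩}

/-- The bigraded piece `(C^t)_(k,j)` of the Čech complex. -/
def cochainPiece (t : ℕ) (k j : ℤ) : Submodule K (CechCochain K Δ t) :=
  Submodule.pi Set.univ fun F => locPiece K Δ F.1 k j

/-- The bigraded piece `H^i_P(R)_(k,j)`: the classes of the cocycles of bidegree `(k, j)`. -/
def cohomologyPiece (i : ℕ) (k j : ℤ) : Submodule K (LocalCohomology K Δ i) :=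
  ((cochainPiece K Δ i k j).comap
    ((LinearMap.ker (cechD K Δ i)).subtype.restrictScalars K)).map
    ((cohomologyClass K Δ i).restrictScalars K)

/-- The `R_0`-module `H^i_P(R)_j`, the sum over all `k` of the pieces `H^i_P(R)_(k,j)`. -/
def cohomologyDegree (i : ℕ) (j : ℤ) : Submodule (ringZero K Δ) (LocalCohomology K Δ i) :=
  Submodule.span (ringZero K Δ) (⋃ k : ℤ, (cohomologyPiece K Δ i k j : Set (LocalCohomology K Δ i)))

/-- The Hilbert series `∑_{k ≥ 0} dim_K H^i_P(R)_(k,j) s^k` of `H^i_P(R)_j`. -/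
def hilbertSeries (i : ℕ) (j : ℤ) : PowerSeries ℚ :=
  PowerSeries.mk fun k => (Module.finrank K (cohomologyPiece K Δ i k j) : ℚ)

end

/-- For `Q = ∑ B_r s^r` with coefficients `B_r ∈ ℚ[j]`, the polynomial `Q_j = ∑ B_r(j) s^r`. -/
def specialize (Q : ℚ[X][X]) (j : ℤ) : ℚ[X] :=
  Q.map (evalRingHom (j : ℚ))

end

end MonomialTame

/-!
The ring `R`, its localizations, the Čech complex and its cohomology are graded by multidegrees in
`ℤ ^ (m + n)`, and the whole statement follows from the shape of this finer grading.

The localization of `R` at `y^F` has a `K`-basis of Laurent monomials: one for each multidegree `e`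
that is negative only at variables `y j` with `j ∈ F`, and for which `supp e ∪ F` is a face
(`Admissible`, `coord_laurentMono`, `coord_ext`). The coefficient functionals are obtained by
mapping the localization to the Laurent polynomial ring of that face. The maps of the Čech complex
take Laurent monomials to Laurent monomials or to `0`, so the component of multidegree `e` of the
complex is a complex of finite-dimensional vector spaces which depends only on the signs of the
entries of `e`. If `e` is positive at some `y j`, then the components at `F` and at `F ∪ {j}` agree,
and the complex is exact (`cochainShift_mem_coboundaries_of_pos`). Hence `H^i_P(R)` lives in the
multidegrees `(a, -b)` with `a` and `b` nonnegative; its component there has a dimension that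
depends only on the supports `A` of `a` and `G` of `b` (`signDim`), and multiplication by `x v` with
`v ∈ A` is an isomorphism between components (`ringMono_smul_cohomologyProj_of_sameSign`).

Counting the `a` with support `A` gives the series `(s / (1 - s)) ^ |A|`, and the number of `b` with
support `G` and sum `-j` is `binom (-j - 1, |G| - 1)` for `j < 0`. So the Hilbert series is the sum
of `hilbertCoeff d (j) * (s / (1 - s)) ^ d` over `d ≤ m`, where the polynomial `hilbertCoeff d` is a
combination of binomial polynomials with nonnegative coefficients. It takes positive values for `j <
-n` as soon as it is nonzero, that is, if some component with `|A| = d` and `G ≠ ∅` is nonzero. With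
`D` the largest such `d`, both `Q` and `Q_j` vanish at `s = 1` of order `m - D`
(`rootMultiplicity_bernsteinSum`).

It remains to see that `D` is the Krull dimension of `H^i_P(R)_j`. A nonzero element in multidegree
`(1_A, -b)` with `|A| = D` is annihilated by no nonzero polynomial in the variables `x v`, `v ∈ A`,
so the ring modulo the annihilator of the module maps onto a polynomial ring in `D` variables
(`le_supportDim_cohomologyDegree`). Conversely, let `B` be the set of the `v` with `x v` outside a
prime in the support. The product of these `x v` does not annihilate the module, so there is a
nonzero component with `A ⊇ B`, and therefore `|B| ≤ D`; the quotient by the prime is an image of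
the polynomial ring in the variables `x v`, `v ∈ B` (`supportDim_cohomologyDegree_le`).
-/

open Polynomial

namespace MonomialTame

noncomputable section

/-! ### Shortcut instances -/

-- These spare instance resolution the way through quotients, localizations and products.

section Shortcuts

variable (K : Type*) [Field K] {m n : ℕ} (Δ : PreAbstractSimplicialComplex (Fin m ⊕ Fin n))

abbrev commRingStanleyReisner : CommRing (StanleyReisnerRing K Δ) := inferInstance

abbrev algebraStanleyReisner : Algebra K (StanleyReisnerRing K Δ) := inferInstance

abbrev commRingCechLoc (F : Finset (Fin n)) : CommRing (CechLoc K Δ F) := inferInstance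

abbrev addCommGroupCechLoc (F : Finset (Fin n)) : AddCommGroup (CechLoc K Δ F) := inferInstance

abbrev addCommMonoidCechLoc (F : Finset (Fin n)) : AddCommMonoid (CechLoc K Δ F) := inferInstance

abbrev algebraCechLoc (F : Finset (Fin n)) : Algebra K (CechLoc K Δ F) := inferInstance

abbrev moduleCechLoc (F : Finset (Fin n)) : Module K (CechLoc K Δ F) := inferInstance

abbrev addCommGroupCechCochain (t : ℕ) : AddCommGroup (CechCochain K Δ t) := inferInstance

abbrev addCommMonoidCechCochain (t : ℕ) : AddCommMonoid (CechCochain K Δ t) := inferInstance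

abbrev moduleCechCochain (t : ℕ) : Module K (CechCochain K Δ t) := inferInstance

abbrev moduleStanleyReisnerCechCochain (t : ℕ) :
    Module (StanleyReisnerRing K Δ) (CechCochain K Δ t) := inferInstance

end Shortcuts

attribute [local instance] commRingStanleyReisner algebraStanleyReisner commRingCechLoc
  addCommGroupCechLoc addCommMonoidCechLoc algebraCechLoc moduleCechLoc addCommGroupCechCochain
  addCommMonoidCechCochain moduleCechCochain moduleStanleyReisnerCechCochain

/-! ### Faces and multidegrees -/

/-- The faces of `Δ` together with the empty face. -/
def IsFace {σ : Type*} (Δ : PreAbstractSimplicialComplex σ) (U : Finset σ) : Prop :=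
  U = ∅ ∨ U ∈ Δ

lemma IsFace.mono {σ : Type*} {Δ : PreAbstractSimplicialComplex σ} {U V : Finset σ}
    (hV : IsFace Δ V) (h : U ⊆ V) : IsFace Δ U := by
  rcases U.eq_empty_or_nonempty with rfl | hU
  · exact Or.inl rfl
  · rcases hV with rfl | hV
    · exact Or.inl (Finset.subset_empty.mp h)
    · exact Or.inr ((Δ.isRelLowerSet_faces hV).2 h hU)

lemma prod_X_mem_of_not_isFace (K : Type*) [Field K] {σ : Type*}
    {Δ : PreAbstractSimplicialComplex σ} {U : Finset σ} (h : ¬ IsFace Δ U) :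
    (∏ v ∈ U, MvPolynomial.X v : MvPolynomial σ K) ∈ stanleyReisnerIdeal K Δ := by
  rw [IsFace, not_or] at h
  exact Ideal.subset_span ⟨U, Finset.nonempty_iff_ne_empty.mpr h.1, h.2, rfl⟩

/-- The set of indices at which the multidegree `e` does not vanish. -/
def degSupport {σ : Type*} [Fintype σ] (e : σ → ℤ) : Finset σ :=
  Finset.univ.filter fun v => e v ≠ 0

@[simp] lemma mem_degSupport {σ : Type*} [Fintype σ] {e : σ → ℤ} {v : σ} :
    v ∈ degSupport e ↔ e v ≠ 0 := by simp [degSupport]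

/-- The exponent vector of a monomial, as a multidegree. -/
def expDeg {σ : Type*} (c : σ →₀ ℕ) : σ → ℤ := fun v => c v

@[simp] lemma expDeg_apply {σ : Type*} (c : σ →₀ ℕ) (v : σ) : expDeg c v = c v := rfl

lemma nsmul_expDeg_apply {σ : Type*} (l : ℕ) (c : σ →₀ ℕ) (v : σ) :
    (l • expDeg c) v = l * c v := by
  rw [Pi.smul_apply, nsmul_eq_mul, expDeg_apply]

section Cutoff

variable (K : Type*) [Field K] {σ : Type*}

open Classical in
/-- The map from the polynomial ring to the Laurent polynomial ring that keeps the variables in `G`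
and sends all others to `0`. -/
def cutoff (G : Finset σ) : MvPolynomial σ K →ₐ[K] AddMonoidAlgebra K (σ → ℤ) :=
  MvPolynomial.aeval fun v => if v ∈ G then AddMonoidAlgebra.single (Pi.single v 1) 1 else 0

open Classical in
lemma cutoff_monomial (G : Finset σ) (c : σ →₀ ℕ) (r : K) :
    cutoff K G (MvPolynomial.monomial c r) =
      if c.support ⊆ G then AddMonoidAlgebra.single (expDeg c) r else 0 := by
  rw [cutoff, MvPolynomial.aeval_monomial]
  split_ifs with h
  · have h1 : (c.prod fun v k =>
          (if v ∈ G then AddMonoidAlgebra.single (Pi.single v (1 : ℤ)) (1 : K) else 0) ^ k) =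
        c.prod fun v k => AddMonoidAlgebra.single (k • Pi.single v (1 : ℤ)) (1 : K) := by
      refine Finsupp.prod_congr fun v hv => ?_
      rw [if_pos (h hv), AddMonoidAlgebra.single_pow, one_pow]
    rw [h1, Finsupp.prod, AddMonoidAlgebra.prod_single, Finset.prod_const_one]
    have h2 : (∑ v ∈ c.support, c v • Pi.single v (1 : ℤ)) = expDeg c := by
      funext w
      rw [Finset.sum_apply]
      simp only [Pi.smul_apply, Pi.single_apply, smul_ite, smul_zero, expDeg_apply,
        Finset.sum_ite_eq, Finsupp.mem_support_iff]
      by_cases hw : c w = 0 <;> simp [hw]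
    rw [h2]
    have : (algebraMap K (AddMonoidAlgebra K (σ → ℤ))) r = AddMonoidAlgebra.single 0 r := rfl
    rw [this, AddMonoidAlgebra.single_mul_single, zero_add, mul_one]
  · obtain ⟨v, hv, hvG⟩ := Finset.not_subset.mp h
    rw [Finsupp.prod, Finset.prod_eq_zero hv, mul_zero]
    rw [if_neg hvG, zero_pow (Finsupp.mem_support_iff.mp hv)]

lemma cutoff_eq_zero {Δ : PreAbstractSimplicialComplex σ} {G : Finset σ} (hG : IsFace Δ G)
    {p : MvPolynomial σ K} (hp : p ∈ stanleyReisnerIdeal K Δ) : cutoff K G p = 0 := by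
  classical
  suffices stanleyReisnerIdeal K Δ ≤ RingHom.ker (cutoff K G) from this hp
  rw [stanleyReisnerIdeal, Ideal.span_le]
  rintro u ⟨F, hF, hF', rfl⟩
  rw [SetLike.mem_coe, RingHom.mem_ker, map_prod]
  have : ¬ F ⊆ G := fun h => by
    rcases hG.mono h with h | h
    · exact hF.ne_empty h
    · exact hF' h
  obtain ⟨v, hv, hvG⟩ := Finset.not_subset.mp this
  refine Finset.prod_eq_zero hv ?_
  rw [cutoff, MvPolynomial.aeval_X, if_neg hvG]

/-- The map induced by `cutoff` on the Stanley–Reisner ring when `G` is a face. -/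
def faceMap {Δ : PreAbstractSimplicialComplex σ} {G : Finset σ} (hG : IsFace Δ G) :
    StanleyReisnerRing K Δ →ₐ[K] AddMonoidAlgebra K (σ → ℤ) :=
  Ideal.Quotient.liftₐ _ (cutoff K G) fun _ hp => cutoff_eq_zero K hG hp

end Cutoff

/-- The vertices `w j` with `j ∈ F`. -/
def yFace {m n : ℕ} (F : Finset (Fin n)) : Finset (Fin m ⊕ Fin n) :=
  F.map Function.Embedding.inr

@[simp] lemma mem_yFace_inr {m n : ℕ} {F : Finset (Fin n)} {j : Fin n} :
    (Sum.inr j : Fin m ⊕ Fin n) ∈ yFace F ↔ j ∈ F := by simp [yFace]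

@[simp] lemma mem_yFace_inl {m n : ℕ} {F : Finset (Fin n)} {j : Fin m} :
    (Sum.inl j : Fin m ⊕ Fin n) ∉ yFace F := by simp [yFace]

/-- The exponent vector of the monomial `y^F`. -/
def yExp {m n : ℕ} (F : Finset (Fin n)) : Fin m ⊕ Fin n →₀ ℕ :=
  Finsupp.indicator (yFace F) fun _ _ => 1

lemma yExp_apply {m n : ℕ} (F : Finset (Fin n)) (v : Fin m ⊕ Fin n) :
    yExp F v = if v ∈ yFace F then 1 else 0 := by simp [yExp, Finsupp.indicator_apply]

lemma support_yExp {m n : ℕ} (F : Finset (Fin n)) :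
    (yExp F : Fin m ⊕ Fin n →₀ ℕ).support = yFace F := by
  ext v; simp [yExp_apply]

/-- The multidegrees of the Laurent monomials that are nonzero in the localization at `y^F`: only
the `y j` with `j ∈ F` have negative exponents, and the support together with `F` is a face. -/
def Admissible {m n : ℕ} (Δ : PreAbstractSimplicialComplex (Fin m ⊕ Fin n)) (F : Finset (Fin n))
    (e : Fin m ⊕ Fin n → ℤ) : Prop :=
  (∀ v, e v < 0 → v ∈ yFace F) ∧ IsFace Δ (degSupport e ∪ yFace F)

lemma degSupport_union_yFace {F : Finset (Fin n)} {e : Fin m ⊕ Fin n → ℤ}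
    {c : Fin m ⊕ Fin n →₀ ℕ} {l : ℕ} (h : expDeg c - l • expDeg (yExp F) = e) :
    degSupport e ∪ yFace F = c.support ∪ yFace F := by
  subst h
  ext v
  by_cases hv : v ∈ yFace F <;> simp [hv, yExp_apply]

/-! ### Laurent monomials in the localizations -/

section Localization

variable (K : Type*) [Field K] {m n : ℕ} (Δ : PreAbstractSimplicialComplex (Fin m ⊕ Fin n))

/-- The residue class of a monomial in the Stanley–Reisner ring. -/
def ringMono (c : Fin m ⊕ Fin n →₀ ℕ) : StanleyReisnerRing K Δ :=
  Ideal.Quotient.mkₐ K (stanleyReisnerIdeal K Δ) (MvPolynomial.monomial c 1)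

lemma ringMono_add (c c' : Fin m ⊕ Fin n →₀ ℕ) :
    ringMono K Δ (c + c') = ringMono K Δ c * ringMono K Δ c' := by
  rw [ringMono, ringMono, ringMono, ← map_mul, MvPolynomial.monomial_mul, one_mul]

lemma ringMono_zero : ringMono K Δ 0 = 1 := by
  rw [ringMono]
  exact map_one _

lemma ringMono_nsmul (c : Fin m ⊕ Fin n →₀ ℕ) (l : ℕ) :
    ringMono K Δ (l • c) = ringMono K Δ c ^ l := by
  rw [ringMono, ringMono, ← map_pow, MvPolynomial.monomial_pow, one_pow]

lemma monomial_indicator_one {σ : Type*} (U : Finset σ) :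
    MvPolynomial.monomial (Finsupp.indicator U fun _ _ => 1) (1 : K) =
      ∏ v ∈ U, MvPolynomial.X v := by
  classical
  rw [MvPolynomial.monomial_eq, map_one, one_mul, Finsupp.prod]
  have : (Finsupp.indicator U fun _ _ => 1).support = U := by
    ext v; simp [Finsupp.indicator_apply]
  rw [this]
  refine Finset.prod_congr rfl fun v hv => ?_
  rw [Finsupp.indicator_apply, dif_pos hv, pow_one]

lemma ringMono_yExp (F : Finset (Fin n)) : ringMono K Δ (yExp F) = yProd K Δ F := by
  rw [ringMono, yExp, monomial_indicator_one, yFace, Finset.prod_map, map_prod]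
  rfl

lemma ringMono_eq_zero {c : Fin m ⊕ Fin n →₀ ℕ} (h : ¬ IsFace Δ c.support) :
    ringMono K Δ c = 0 := by
  rw [ringMono]
  refine Ideal.Quotient.eq_zero_iff_mem.mpr ?_
  have hle : Finsupp.indicator c.support (fun _ _ => 1) ≤ c := fun v => by
    classical
    rw [Finsupp.indicator_apply]
    split_ifs with h
    · exact Nat.one_le_iff_ne_zero.mpr (Finsupp.mem_support_iff.mp h)
    · exact Nat.zero_le _
  rw [← add_tsub_cancel_of_le hle, ← mul_one (1 : K), ← MvPolynomial.monomial_mul,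
    monomial_indicator_one]
  exact Ideal.mul_mem_right _ _ (prod_X_mem_of_not_isFace K h)

open Classical in
lemma faceMap_ringMono {G : Finset (Fin m ⊕ Fin n)} (hG : IsFace Δ G) (c : Fin m ⊕ Fin n →₀ ℕ) :
    faceMap K hG (ringMono K Δ c) =
      if c.support ⊆ G then AddMonoidAlgebra.single (expDeg c) 1 else 0 := by
  change cutoff K G (MvPolynomial.monomial c 1) = _
  rw [cutoff_monomial]
  split_ifs <;> rfl

lemma isUnit_faceMap {G : Finset (Fin m ⊕ Fin n)} (hG : IsFace Δ G) {F : Finset (Fin n)}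
    (hF : yFace F ⊆ G) (y : Submonoid.powers (yProd K Δ F)) :
    IsUnit (faceMap K hG (y : StanleyReisnerRing K Δ)) := by
  obtain ⟨_, l, rfl⟩ := y
  rw [map_pow]
  refine IsUnit.pow l ?_
  rw [← ringMono_yExp, faceMap_ringMono, support_yExp, if_pos hF]
  exact IsUnit.of_mul_eq_one (AddMonoidAlgebra.single (-expDeg (yExp F)) 1)
    (by rw [AddMonoidAlgebra.single_mul_single, add_neg_cancel, one_mul]; rfl)

/-- The extension of `faceMap` to the localization at `y^F`, where `F` is contained in the face
`G`. -/
def faceLoc {G : Finset (Fin m ⊕ Fin n)} (hG : IsFace Δ G) {F : Finset (Fin n)}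
    (hF : yFace F ⊆ G) : CechLoc K Δ F →ₐ[K] AddMonoidAlgebra K (Fin m ⊕ Fin n → ℤ) :=
  IsLocalization.liftAlgHom (M := Submonoid.powers (yProd K Δ F)) (f := faceMap K hG)
    (isUnit_faceMap K Δ hG hF)

/-- The fraction `z^c / (y^F)^l`, where `z^c` is a monomial in all the variables. -/
def monoFrac (F : Finset (Fin n)) (c : Fin m ⊕ Fin n →₀ ℕ) (l : ℕ) : CechLoc K Δ F :=
  Localization.mk (ringMono K Δ c) ⟨yProd K Δ F ^ l, pow_mem (Submonoid.mem_powers _) l⟩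

open Classical in
lemma faceLoc_monoFrac {G : Finset (Fin m ⊕ Fin n)} (hG : IsFace Δ G) {F : Finset (Fin n)}
    (hF : yFace F ⊆ G) (c : Fin m ⊕ Fin n →₀ ℕ) (l : ℕ) :
    faceLoc K Δ hG hF (monoFrac K Δ F c l) =
      if c.support ⊆ G then AddMonoidAlgebra.single (expDeg c - l • expDeg (yExp F)) 1 else 0 := by
  rw [faceLoc, IsLocalization.liftAlgHom_apply, monoFrac, Localization.mk_eq_mk',
    IsLocalization.lift_mk'_spec]
  change faceMap K hG _ = faceMap K hG (yProd K Δ F ^ l) * _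
  rw [map_pow, ← ringMono_yExp, faceMap_ringMono, faceMap_ringMono, support_yExp, if_pos hF]
  split_ifs with h
  · rw [AddMonoidAlgebra.single_pow, one_pow, AddMonoidAlgebra.single_mul_single, one_mul,
      add_sub_cancel]
  · rw [mul_zero]

open Classical in
/-- The coefficient of the Laurent monomial of multidegree `e` in an element of the localization at
`y^F`. It is computed in the Laurent polynomial ring of the face `supp e ∪ F`, if this is a face. -/
def coord (F : Finset (Fin n)) (e : Fin m ⊕ Fin n → ℤ) : CechLoc K Δ F →ₗ[K] K :=
  if h : IsFace Δ (degSupport e ∪ yFace F) then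
    (Finsupp.lapply e ∘ₗ (AddMonoidAlgebra.coeffLinearEquiv K).toLinearMap) ∘ₗ
      (faceLoc K Δ h Finset.subset_union_right).toLinearMap
  else 0

open Classical in
lemma coord_monoFrac (F : Finset (Fin n)) (e : Fin m ⊕ Fin n → ℤ) (c : Fin m ⊕ Fin n →₀ ℕ)
    (l : ℕ) : coord K Δ F e (monoFrac K Δ F c l) =
      if IsFace Δ (c.support ∪ yFace F) ∧ expDeg c - l • expDeg (yExp F) = e then 1 else 0 := by
  rw [coord]
  split_ifs with h1 h2 h2
  · obtain ⟨h2, h3⟩ := h2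
    simp only [LinearMap.comp_apply, AlgHom.toLinearMap_apply, faceLoc_monoFrac]
    rw [degSupport_union_yFace h3, if_pos Finset.subset_union_left, h3]
    exact (Finsupp.single_apply).trans (if_pos rfl)
  · simp only [LinearMap.comp_apply, AlgHom.toLinearMap_apply, faceLoc_monoFrac]
    have h3 : ¬ expDeg c - l • expDeg (yExp F) = e := fun h => h2 ⟨degSupport_union_yFace h ▸ h1, h⟩
    split_ifs
    · exact (Finsupp.single_apply).trans (if_neg h3)
    · exact map_zero _
  · exact absurd (degSupport_union_yFace h2.2 ▸ h2.1) h1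
  · rfl

/-- Multiplication by `y^F` turns the numerator into a monomial whose support is not a face. -/
lemma monoFrac_eq_zero {F : Finset (Fin n)} {c : Fin m ⊕ Fin n →₀ ℕ}
    (h : ¬ IsFace Δ (c.support ∪ yFace F)) (l : ℕ) : monoFrac K Δ F c l = 0 := by
  rw [monoFrac, Localization.mk_eq_mk', IsLocalization.mk'_eq_zero_iff]
  refine ⟨⟨yProd K Δ F, Submonoid.mem_powers _⟩, ?_⟩
  change yProd K Δ F * _ = 0
  rw [← ringMono_yExp, ← ringMono_add]
  refine ringMono_eq_zero K Δ fun h' => h (h'.mono fun v hv => ?_)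
  rw [Finset.mem_union, ← support_yExp, Finsupp.mem_support_iff, Finsupp.mem_support_iff] at hv
  rw [Finsupp.mem_support_iff, Finsupp.add_apply]
  omega

lemma monoFrac_add_nsmul (F : Finset (Fin n)) (c : Fin m ⊕ Fin n →₀ ℕ) (l l' : ℕ) :
    monoFrac K Δ F (c + l' • yExp F) (l + l') = monoFrac K Δ F c l := by
  rw [monoFrac, monoFrac, Localization.mk_eq_mk_iff, Localization.r_iff_exists]
  refine ⟨1, ?_⟩
  rw [ringMono_add, ringMono_nsmul, ringMono_yExp]
  push_cast
  ring

lemma monoFrac_congr {F : Finset (Fin n)} {c c' : Fin m ⊕ Fin n →₀ ℕ} {l l' : ℕ}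
    (h : expDeg c - l • expDeg (yExp F) = expDeg c' - l' • expDeg (yExp F)) :
    monoFrac K Δ F c l = monoFrac K Δ F c' l' := by
  rw [← monoFrac_add_nsmul K Δ F c l l', ← monoFrac_add_nsmul K Δ F c' l' l, add_comm l l']
  congr 1
  ext v
  have := congrFun h v
  simp only [Pi.sub_apply, nsmul_expDeg_apply, expDeg_apply] at this
  simp only [Finsupp.add_apply, Finsupp.smul_apply, smul_eq_mul]
  zify
  linarith

lemma monoFrac_mul (F : Finset (Fin n)) (c c' : Fin m ⊕ Fin n →₀ ℕ) (l : ℕ) :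
    ringMono K Δ c' • monoFrac K Δ F c l = monoFrac K Δ F (c' + c) l := by
  rw [monoFrac, monoFrac, Localization.smul_mk, ringMono_add, smul_eq_mul]

open Classical in
/-- The Laurent monomial of multidegree `e` in the localization at `y^F`, with the value `0` if it
has a negative exponent at a variable that is not inverted. It vanishes also if `supp e ∪ F` is not
a face. -/
def laurentMono (F : Finset (Fin n)) (e : Fin m ⊕ Fin n → ℤ) : CechLoc K Δ F :=
  if h : ∃ (c : Fin m ⊕ Fin n →₀ ℕ) (l : ℕ), expDeg c - l • expDeg (yExp F) = e then
    monoFrac K Δ F h.choose h.choose_spec.choose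
  else 0

lemma laurentMono_of_eq {F : Finset (Fin n)} {e : Fin m ⊕ Fin n → ℤ} {c : Fin m ⊕ Fin n →₀ ℕ}
    {l : ℕ} (h : expDeg c - l • expDeg (yExp F) = e) :
    laurentMono K Δ F e = monoFrac K Δ F c l := by
  have h' : ∃ (c : Fin m ⊕ Fin n →₀ ℕ) (l : ℕ), expDeg c - l • expDeg (yExp F) = e := ⟨c, l, h⟩
  rw [laurentMono, dif_pos h']
  exact monoFrac_congr K Δ (h'.choose_spec.choose_spec.trans h.symm)

/-- If `e` is negative only at `F`, then `z^e` is a fraction `z^c / (y^F)^l`. -/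
lemma exists_expDeg_sub {F : Finset (Fin n)} {e : Fin m ⊕ Fin n → ℤ}
    (h : ∀ v, e v < 0 → v ∈ yFace F) :
    ∃ (c : Fin m ⊕ Fin n →₀ ℕ) (l : ℕ), expDeg c - l • expDeg (yExp F) = e := by
  have hle : ∀ v, (e v).natAbs ≤ ∑ w, (e w).natAbs := fun v =>
    Finset.single_le_sum (f := fun w => (e w).natAbs) (fun _ _ => Nat.zero_le _) (Finset.mem_univ v)
  refine ⟨Finsupp.equivFunOnFinite.symm fun v =>
    (e v + ((∑ w, (e w).natAbs) • expDeg (yExp F)) v).toNat, ∑ w, (e w).natAbs, ?_⟩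
  funext v
  have := hle v
  have hv := h v
  generalize ∑ w, (e w).natAbs = N at *
  simp only [Pi.sub_apply, nsmul_expDeg_apply, expDeg_apply,
    Finsupp.coe_equivFunOnFinite_symm, yExp_apply]
  split_ifs with h'
  · push_cast; omega
  · simp only [h', imp_false, not_lt] at hv
    push_cast; omega

lemma neg_mem_of_expDeg_sub {F : Finset (Fin n)} {e : Fin m ⊕ Fin n → ℤ}
    {c : Fin m ⊕ Fin n →₀ ℕ} {l : ℕ} (h : expDeg c - l • expDeg (yExp F) = e) :
    ∀ v, e v < 0 → v ∈ yFace F := by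
  intro v hv
  by_contra hF
  simp [← h, yExp_apply, hF] at hv
  omega

lemma laurentMono_eq_zero {F : Finset (Fin n)} {e : Fin m ⊕ Fin n → ℤ}
    (h : ¬ Admissible Δ F e) : laurentMono K Δ F e = 0 := by
  by_cases h' : ∀ v, e v < 0 → v ∈ yFace F
  · obtain ⟨c, l, hcl⟩ := exists_expDeg_sub h'
    rw [laurentMono_of_eq K Δ hcl]
    refine monoFrac_eq_zero K Δ (fun hf => h ⟨h', ?_⟩) l
    rwa [degSupport_union_yFace hcl]
  · rw [laurentMono, dif_neg]
    rintro ⟨c, l, hcl⟩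
    exact h' (neg_mem_of_expDeg_sub hcl)

open Classical in
lemma coord_laurentMono (F : Finset (Fin n)) (e e' : Fin m ⊕ Fin n → ℤ) :
    coord K Δ F e' (laurentMono K Δ F e) = if Admissible Δ F e ∧ e = e' then 1 else 0 := by
  by_cases h : Admissible Δ F e
  · obtain ⟨c, l, hcl⟩ := exists_expDeg_sub h.1
    rw [laurentMono_of_eq K Δ hcl, coord_monoFrac, hcl]
    have : IsFace Δ (c.support ∪ yFace F) := degSupport_union_yFace hcl ▸ h.2
    simp [h, this]
  · rw [laurentMono_eq_zero K Δ h, map_zero, if_neg (fun h' => h h'.1)]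

lemma span_laurentMono (F : Finset (Fin n)) :
    Submodule.span K (Set.range (laurentMono K Δ F)) = ⊤ := by
  rw [eq_top_iff]
  rintro z -
  induction z using Localization.induction_on with
  | H y =>
    obtain ⟨r, ⟨_, l, rfl⟩⟩ := y
    obtain ⟨p, rfl⟩ := Ideal.Quotient.mk_surjective r
    induction p using MvPolynomial.induction_on' with
    | monomial c a =>
      have : (Localization.mk ((Ideal.Quotient.mk (stanleyReisnerIdeal K Δ))
            (MvPolynomial.monomial c a)) ⟨yProd K Δ F ^ l, l, rfl⟩ : CechLoc K Δ F) =
          a • laurentMono K Δ F (expDeg c - l • expDeg (yExp F)) := by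
        rw [laurentMono_of_eq K Δ rfl, monoFrac, Localization.smul_mk, ringMono, ← map_smul,
          MvPolynomial.smul_monomial, smul_eq_mul, mul_one]
        rfl
      dsimp only
      rw [this]
      exact Submodule.smul_mem _ _ (Submodule.subset_span ⟨_, rfl⟩)
    | add p q hp hq =>
      dsimp only at *
      rw [map_add, ← Localization.add_mk_self]
      exact Submodule.add_mem _ hp hq

/-- Two linear maps on the localization at `y^F` agree if they agree on the Laurent monomials. -/
lemma linearMap_ext_laurentMono {F : Finset (Fin n)} {W : Type*} [AddCommGroup W] [Module K W]
    {f g : CechLoc K Δ F →ₗ[K] W}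
    (h : ∀ e, Admissible Δ F e → f (laurentMono K Δ F e) = g (laurentMono K Δ F e)) : f = g := by
  refine LinearMap.ext_on_range (span_laurentMono K Δ F) fun e => ?_
  by_cases he : Admissible Δ F e
  · exact h e he
  · rw [laurentMono_eq_zero K Δ he, map_zero, map_zero]

lemma finite_coord_ne_zero (F : Finset (Fin n)) (z : CechLoc K Δ F) :
    {e | coord K Δ F e z ≠ 0}.Finite := by
  classical
  have hz : z ∈ Submodule.span K (Set.range (laurentMono K Δ F)) := by
    rw [span_laurentMono]; trivial
  induction hz using Submodule.span_induction with
  | mem x hx =>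
    obtain ⟨e, rfl⟩ := hx
    refine (Set.finite_singleton e).subset fun e' he' => ?_
    simp only [Set.mem_ofPred_eq, coord_laurentMono] at he'
    by_contra hne
    exact he' (if_neg fun h => hne h.2.symm)
  | zero => simp
  | add x y _ _ hx hy =>
    refine (hx.union hy).subset fun e he => ?_
    by_contra hne
    simp only [Set.mem_union, Set.mem_ofPred_eq, not_or, not_not] at hne
    exact he (by rw [map_add, hne.1, hne.2, add_zero])
  | smul a x _ hx =>
    refine hx.subset fun e he h => he ?_
    rw [map_smul, h, smul_zero]

lemma eq_sum_coord (F : Finset (Fin n)) (z : CechLoc K Δ F) :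
    z = ∑ᶠ e, coord K Δ F e z • laurentMono K Δ F e := by
  classical
  have hz : z ∈ Submodule.span K (Set.range (laurentMono K Δ F)) := by
    rw [span_laurentMono]; trivial
  have hfin : ∀ x, (Function.support fun e => coord K Δ F e x • laurentMono K Δ F e).Finite :=
    fun x => (finite_coord_ne_zero K Δ F x).subset fun e he h => he (by
      change coord K Δ F e x • _ = 0
      rw [h, zero_smul])
  induction hz using Submodule.span_induction with
  | mem x hx =>
    obtain ⟨e, rfl⟩ := hx
    rw [finsum_eq_single _ e fun e' he' => by
      rw [coord_laurentMono, if_neg fun h => he' h.2.symm, zero_smul], coord_laurentMono]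
    split_ifs with h
    · rw [one_smul]
    · rw [zero_smul, laurentMono_eq_zero K Δ fun h' => h ⟨h', rfl⟩]
  | zero => simp
  | add x y _ _ hx hy =>
    conv_lhs => rw [hx, hy]
    simp only [map_add, add_smul]
    exact (finsum_add_distrib (hfin x) (hfin y)).symm
  | smul a x _ hx =>
    conv_lhs => rw [hx]
    simp only [map_smul, smul_assoc]
    exact smul_finsum' a (hfin x)

/-- The coefficients determine an element of the localization: together with `coord_laurentMono`
this says that the Laurent monomials of admissible multidegree form a basis. -/
lemma coord_ext {F : Finset (Fin n)} {z z' : CechLoc K Δ F}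
    (h : ∀ e, coord K Δ F e z = coord K Δ F e z') : z = z' := by
  rw [eq_sum_coord K Δ F z, eq_sum_coord K Δ F z']
  simp only [h]

lemma admissible_of_coord_ne_zero {F : Finset (Fin n)} {z : CechLoc K Δ F}
    {e : Fin m ⊕ Fin n → ℤ} (h : coord K Δ F e z ≠ 0) : Admissible Δ F e := by
  classical
  by_contra hadm
  refine h (LinearMap.congr_fun (g := 0) (linearMap_ext_laurentMono K Δ fun e' he' => ?_) z)
  rw [coord_laurentMono, if_neg, LinearMap.zero_apply]
  rintro ⟨h1, rfl⟩
  exact hadm h1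

lemma ringMono_smul_laurentMono {F : Finset (Fin n)} {e : Fin m ⊕ Fin n → ℤ}
    (he : Admissible Δ F e) (c : Fin m ⊕ Fin n →₀ ℕ) :
    ringMono K Δ c • laurentMono K Δ F e = laurentMono K Δ F (e + expDeg c) := by
  obtain ⟨c', l, h⟩ := exists_expDeg_sub he.1
  rw [laurentMono_of_eq K Δ h, monoFrac_mul, laurentMono_of_eq K Δ (c := c + c') (l := l)]
  rw [← h]
  funext v
  simp
  ring

open Classical in
lemma coord_ringMono_smul (F : Finset (Fin n)) (c : Fin m ⊕ Fin n →₀ ℕ)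
    (e : Fin m ⊕ Fin n → ℤ) (z : CechLoc K Δ F) :
    coord K Δ F (e + expDeg c) (ringMono K Δ c • z) =
      if Admissible Δ F (e + expDeg c) then coord K Δ F e z else 0 := by
  refine Eq.trans (b := (if Admissible Δ F (e + expDeg c) then coord K Δ F e else 0) z) ?_
    (by split_ifs <;> rfl)
  refine LinearMap.congr_fun (f := coord K Δ F (e + expDeg c) ∘ₗ
    (LinearMap.lsmul (StanleyReisnerRing K Δ) (CechLoc K Δ F)
      (ringMono K Δ c)).restrictScalars K) (linearMap_ext_laurentMono K Δ fun e' he' => ?_) z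
  change coord K Δ F (e + expDeg c) (ringMono K Δ c • laurentMono K Δ F e') = _
  rw [ringMono_smul_laurentMono K Δ he', coord_laurentMono]
  by_cases h : Admissible Δ F (e + expDeg c)
  · rw [if_pos h, coord_laurentMono]
    by_cases h' : e' = e
    · subst h'; simp [h, he']
    · simp [h']
  · rw [if_neg h, LinearMap.zero_apply, if_neg]
    rintro ⟨h1, h2⟩
    exact h (h2 ▸ h1)

lemma cechMap_laurentMono {F F' : Finset (Fin n)} (h : F ⊆ F') {e : Fin m ⊕ Fin n → ℤ}
    (he : Admissible Δ F e) :
    cechMap K Δ h (laurentMono K Δ F e) = laurentMono K Δ F' e := by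
  obtain ⟨c, l, hcl⟩ := exists_expDeg_sub he.1
  have h2 : (yExp F' : Fin m ⊕ Fin n →₀ ℕ) = yExp F + yExp (F' \ F) := by
    ext v
    rcases v with v | v
    · simp [yExp_apply]
    · have := @h v
      simp only [yExp_apply, mem_yFace_inr, Finsupp.add_apply, Finset.mem_sdiff]
      split_ifs <;> simp_all
  rw [laurentMono_of_eq K Δ hcl, laurentMono_of_eq K Δ (F := F')
    (c := c + l • yExp (F' \ F)) (l := l)]
  · change IsLocalization.lift _ _ = _
    rw [monoFrac, monoFrac, Localization.mk_eq_mk', IsLocalization.lift_mk'_spec]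
    change algebraMap (StanleyReisnerRing K Δ) (CechLoc K Δ F') _ =
      algebraMap (StanleyReisnerRing K Δ) (CechLoc K Δ F') (yProd K Δ F ^ l) * _
    rw [ Localization.mk_eq_mk', ← IsLocalization.mk'_one (M := Submonoid.powers (yProd K Δ F')),
      ← IsLocalization.mk'_one (M := Submonoid.powers (yProd K Δ F')), ← IsLocalization.mk'_mul,
      IsLocalization.mk'_eq_iff_eq]
    congr 1
    simp only [one_mul, OneMemClass.coe_one, ← ringMono_yExp, ← ringMono_add, ← ringMono_nsmul]
    congr 1
    rw [h2, smul_add]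
    abel
  · rw [← hcl]
    funext v
    simp [h2]
    ring

open Classical in
lemma coord_cechMap {F F' : Finset (Fin n)} (h : F ⊆ F') (e : Fin m ⊕ Fin n → ℤ)
    (z : CechLoc K Δ F) :
    coord K Δ F' e (cechMap K Δ h z) =
      if IsFace Δ (degSupport e ∪ yFace F') then coord K Δ F e z else 0 := by
  refine Eq.trans (b := (if IsFace Δ (degSupport e ∪ yFace F') then coord K Δ F e else 0) z) ?_
    (by split_ifs <;> rfl)
  refine LinearMap.congr_fun (f := coord K Δ F' e ∘ₗ
    ((cechMap K Δ h).toLinearMap).restrictScalars K)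
    (linearMap_ext_laurentMono K Δ fun e' he' => ?_) z
  change coord K Δ F' e (cechMap K Δ h (laurentMono K Δ F e')) = _
  rw [cechMap_laurentMono K Δ h he', coord_laurentMono]
  by_cases hf : IsFace Δ (degSupport e ∪ yFace F')
  · rw [if_pos hf, coord_laurentMono]
    by_cases h' : e' = e
    · subst h'
      have : Admissible Δ F' e' := ⟨fun v hv => Finset.map_subset_map.mpr h (he'.1 v hv), hf⟩
      simp [he', this]
    · simp [h']
  · rw [if_neg hf, LinearMap.zero_apply, if_neg]
    rintro ⟨h1, h2⟩
    exact hf (h2 ▸ h1.2)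

end Localization

/-! ### Multigraded components of Čech cochains -/

/-- Two multidegrees have the same sign pattern. -/
def SameSign {σ : Type*} (e e' : σ → ℤ) : Prop := ∀ v, SignType.sign (e v) = SignType.sign (e' v)

lemma SameSign.refl {σ : Type*} (e : σ → ℤ) : SameSign e e := fun _ => rfl

lemma SameSign.symm {σ : Type*} {e e' : σ → ℤ} (h : SameSign e e') : SameSign e' e :=
  fun v => (h v).symm

lemma SameSign.trans {σ : Type*} {e e' e'' : σ → ℤ} (h : SameSign e e') (h' : SameSign e' e'') :
    SameSign e e'' :=
  fun v => (h v).trans (h' v)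

lemma SameSign.neg_iff {σ : Type*} {e e' : σ → ℤ} (h : SameSign e e') (v : σ) :
    e v < 0 ↔ e' v < 0 := by
  rw [← sign_eq_neg_one_iff, h v, sign_eq_neg_one_iff]

lemma SameSign.degSupport_eq {σ : Type*} [Fintype σ] {e e' : σ → ℤ} (h : SameSign e e') :
    degSupport e = degSupport e' := by
  ext v
  rw [mem_degSupport, mem_degSupport, ← sign_ne_zero, h v, sign_ne_zero]

lemma SameSign.admissible_iff {m n : ℕ} {Δ : PreAbstractSimplicialComplex (Fin m ⊕ Fin n)}
    {e e' : Fin m ⊕ Fin n → ℤ} (h : SameSign e e') (F : Finset (Fin n)) :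
    Admissible Δ F e ↔ Admissible Δ F e' := by
  rw [Admissible, Admissible, h.degSupport_eq]
  simp only [h.neg_iff]

/-- The sign with which `F \ {j} ⊆ F` enters the Čech differential. -/
def cechSign {n : ℕ} (F : Finset (Fin n)) (j : Fin n) : ℤ := (-1) ^ (F.filter (· < j)).card

lemma cechSign_mul_self {n : ℕ} (F : Finset (Fin n)) (j : Fin n) :
    cechSign F j * cechSign F j = 1 := by
  rw [cechSign, ← mul_pow]
  norm_num

/-- The two ways of removing `j` and `k` from a set enter `d ∘ d` with opposite signs. -/
lemma cechSign_insert_erase {n : ℕ} {F : Finset (Fin n)} {j k : Fin n} (hj : j ∉ F) (hk : k ∈ F) :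
    cechSign F k * cechSign (insert j (F.erase k)) j =
      -(cechSign (insert j F) j * cechSign (insert j F) k) := by
  have hjk : j ≠ k := fun h => hj (h ▸ hk)
  have h1 : (insert j (F.erase k)).filter (· < j) = (F.filter (· < j)).erase k := by
    rw [Finset.filter_insert, if_neg (lt_irrefl j), Finset.filter_erase]
  have h2 : (insert j F).filter (· < j) = F.filter (· < j) := by
    rw [Finset.filter_insert, if_neg (lt_irrefl j)]
  rw [cechSign, cechSign, cechSign, cechSign, h1, h2, Finset.filter_insert]
  rcases lt_or_gt_of_ne hjk with h | h
  · rw [if_pos h, Finset.card_insert_of_notMem (by simp [hj]),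
      Finset.erase_eq_of_notMem (by simp [h.le]), pow_succ]
    ring
  · rw [if_neg h.not_gt]
    have h3 := Finset.card_erase_add_one (Finset.mem_filter.mpr ⟨hk, h⟩ : k ∈ F.filter (· < j))
    rw [← h3, pow_succ]
    ring

section Cochains

variable (K : Type*) [Field K] {m n : ℕ} (Δ : PreAbstractSimplicialComplex (Fin m ⊕ Fin n))

/-- The coefficient of the Laurent monomial of multidegree `e` in the component of a cochain at
`F`, with the value `0` if `F` does not have `t` elements. -/
def cochainCoord (t : ℕ) (F : Finset (Fin n)) (e : Fin m ⊕ Fin n → ℤ) : CechCochain K Δ t →ₗ[K] K :=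
  if h : F.card = t then
    coord K Δ F e ∘ₗ LinearMap.proj (⟨F, h⟩ : {F : Finset (Fin n) // F.card = t})
  else 0

lemma cochainCoord_of_card {t : ℕ} {F : Finset (Fin n)} (h : F.card = t)
    (e : Fin m ⊕ Fin n → ℤ) (z : CechCochain K Δ t) :
    cochainCoord K Δ t F e z = coord K Δ F e (z ⟨F, h⟩) := by
  rw [cochainCoord, dif_pos h]
  rfl

lemma cochainCoord_of_card_ne {t : ℕ} {F : Finset (Fin n)} (h : F.card ≠ t)
    (e : Fin m ⊕ Fin n → ℤ) (z : CechCochain K Δ t) : cochainCoord K Δ t F e z = 0 := by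
  rw [cochainCoord, dif_neg h]
  rfl

lemma cochain_ext {t : ℕ} {z z' : CechCochain K Δ t}
    (h : ∀ F, F.card = t → ∀ e, cochainCoord K Δ t F e z = cochainCoord K Δ t F e z') :
    z = z' := by
  funext F
  refine coord_ext K Δ fun e => ?_
  rw [← cochainCoord_of_card K Δ F.2, ← cochainCoord_of_card K Δ F.2]
  exact h F.1 F.2 e

lemma admissible_of_cochainCoord_ne_zero {t : ℕ} {F : Finset (Fin n)} {e : Fin m ⊕ Fin n → ℤ}
    {z : CechCochain K Δ t} (h : cochainCoord K Δ t F e z ≠ 0) : Admissible Δ F e := by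
  by_cases hF : F.card = t
  · rw [cochainCoord_of_card K Δ hF] at h
    exact admissible_of_coord_ne_zero K Δ h
  · exact absurd (cochainCoord_of_card_ne K Δ hF e z) h

lemma finite_cochainCoord_ne_zero {t : ℕ} (z : CechCochain K Δ t) :
    {e | ∃ F, cochainCoord K Δ t F e z ≠ 0}.Finite := by
  rw [show {e | ∃ F, cochainCoord K Δ t F e z ≠ 0} =
    ⋃ F, {e | cochainCoord K Δ t F e z ≠ 0} by ext; simp]
  refine Set.finite_iUnion fun F => ?_
  by_cases hF : F.card = t
  · simp only [cochainCoord_of_card K Δ hF]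
    exact finite_coord_ne_zero K Δ F _
  · simp [cochainCoord_of_card_ne K Δ hF]

open Classical in
lemma cochainCoord_ringMono_smul {t : ℕ} {F : Finset (Fin n)} (hF : F.card = t)
    (c : Fin m ⊕ Fin n →₀ ℕ) (e : Fin m ⊕ Fin n → ℤ) (z : CechCochain K Δ t) :
    cochainCoord K Δ t F (e + expDeg c) (ringMono K Δ c • z) =
      if Admissible Δ F (e + expDeg c) then cochainCoord K Δ t F e z else 0 := by
  rw [cochainCoord_of_card K Δ hF, cochainCoord_of_card K Δ hF, Pi.smul_apply, coord_ringMono_smul]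

open Classical in
lemma cochainCoord_cechD {t : ℕ} {F : Finset (Fin n)} (hF : F.card = t + 1)
    (e : Fin m ⊕ Fin n → ℤ) (z : CechCochain K Δ t) :
    cochainCoord K Δ (t + 1) F e (cechD K Δ t z) =
      if IsFace Δ (degSupport e ∪ yFace F) then
        ∑ j ∈ F, cechSign F j • cochainCoord K Δ t (F.erase j) e z else 0 := by
  rw [cochainCoord_of_card K Δ hF, cechD, LinearMap.pi_apply, LinearMap.sum_apply, map_sum]
  have key : ∀ j : {j : Fin n // j ∈ F}, coord K Δ F e
      (((-1 : ℤ) ^ (F.filter (· < j.1)).card •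
      ((cechMap K Δ (Finset.erase_subset j.1 F)).toLinearMap ∘ₗ
        LinearMap.proj (⟨F.erase j.1, by
          rw [Finset.card_erase_of_mem j.2, hF, Nat.add_sub_cancel]⟩ :
            {F : Finset (Fin n) // F.card = t}))) z) =
      if IsFace Δ (degSupport e ∪ yFace F) then
        cechSign F j • cochainCoord K Δ t (F.erase j) e z else 0 := fun j => by
    have hsmul : ∀ (N : ℤ) (φ : CechCochain K Δ t →ₗ[StanleyReisnerRing K Δ] CechLoc K Δ F),
        coord K Δ F e ((N • φ) z) = N • coord K Δ F e (φ z) := fun N φ =>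
      map_zsmul (((coord K Δ F e).toAddMonoidHom.comp (AddMonoidHom.eval z)).comp
        LinearMap.toAddMonoidHom') N φ
    rw [hsmul, LinearMap.comp_apply, LinearMap.proj_apply,
      AlgHom.toLinearMap_apply, coord_cechMap, cochainCoord_of_card K Δ (F := F.erase j.1)
        (by rw [Finset.card_erase_of_mem j.2, hF, Nat.add_sub_cancel]), smul_ite, smul_zero]
    rfl
  rw [Finset.sum_congr rfl fun j _ => key j]
  split_ifs
  · exact Finset.sum_coe_sort F fun j => cechSign F j • cochainCoord K Δ t (F.erase j) e z
  · exact Finset.sum_const_zero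

/-- The homogeneous cochain of multidegree `e` whose coefficient at `F` is `a F`. -/
def monoCochain (t : ℕ) (e : Fin m ⊕ Fin n → ℤ) (a : Finset (Fin n) → K) : CechCochain K Δ t :=
  fun F => a F.1 • laurentMono K Δ F.1 e

open Classical in
lemma cochainCoord_monoCochain {t : ℕ} {F : Finset (Fin n)} (hF : F.card = t)
    (e e' : Fin m ⊕ Fin n → ℤ) (a : Finset (Fin n) → K) :
    cochainCoord K Δ t F e' (monoCochain K Δ t e a) =
      if Admissible Δ F e ∧ e = e' then a F else 0 := by
  rw [cochainCoord_of_card K Δ hF, monoCochain, map_smul, coord_laurentMono, smul_eq_mul, mul_ite,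
    mul_one, mul_zero]

/-- The linear map that takes the component of multidegree `e` of a cochain, and moves it to
multidegree `e'`. -/
def cochainShift (t : ℕ) (e e' : Fin m ⊕ Fin n → ℤ) :
    CechCochain K Δ t →ₗ[K] CechCochain K Δ t where
  toFun z := monoCochain K Δ t e' fun F => cochainCoord K Δ t F e z
  map_add' z z' := by
    funext F
    simp only [monoCochain, map_add, add_smul, Pi.add_apply]
  map_smul' a z := by
    funext F
    simp only [monoCochain, map_smul, smul_assoc, Pi.smul_apply, RingHom.id_apply]

open Classical in
lemma cochainCoord_cochainShift {t : ℕ} {F : Finset (Fin n)}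
    {e e' : Fin m ⊕ Fin n → ℤ} (h : SameSign e e') (e'' : Fin m ⊕ Fin n → ℤ)
    (z : CechCochain K Δ t) :
    cochainCoord K Δ t F e'' (cochainShift K Δ t e e' z) =
      if e' = e'' then cochainCoord K Δ t F e z else 0 := by
  by_cases hF : F.card = t
  · change cochainCoord K Δ t F e''
      (monoCochain K Δ t e' fun F => cochainCoord K Δ t F e z) = _
    rw [cochainCoord_monoCochain K Δ hF]
    by_cases hz : cochainCoord K Δ t F e z = 0
    · simp [hz]
    · have := (h.admissible_iff F).mp (admissible_of_cochainCoord_ne_zero K Δ hz)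
      simp [this]
  · simp [cochainCoord_of_card_ne K Δ hF]

lemma cechD_cochainShift {t : ℕ} {e e' : Fin m ⊕ Fin n → ℤ} (h : SameSign e e')
    (z : CechCochain K Δ t) :
    cechD K Δ t (cochainShift K Δ t e e' z) = cochainShift K Δ (t + 1) e e' (cechD K Δ t z) := by
  classical
  refine cochain_ext K Δ fun F hF e'' => ?_
  rw [cochainCoord_cochainShift K Δ h, cochainCoord_cechD K Δ hF, cochainCoord_cechD K Δ hF,
    h.degSupport_eq]
  simp only [cochainCoord_cochainShift K Δ h]
  by_cases he : e' = e''
  · simp [he]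
  · simp [he]

lemma cochainShift_comp {t : ℕ} {e e' e'' : Fin m ⊕ Fin n → ℤ} (h : SameSign e e')
    (h' : SameSign e' e'') (z : CechCochain K Δ t) :
    cochainShift K Δ t e' e'' (cochainShift K Δ t e e' z) = cochainShift K Δ t e e'' z := by
  classical
  refine cochain_ext K Δ fun F hF d => ?_
  simp [cochainCoord_cochainShift K Δ h', cochainCoord_cochainShift K Δ h,
    cochainCoord_cochainShift K Δ (h.trans h')]

lemma cochainShift_comp_of_ne {t : ℕ} {e₁ e₂ e₃ e₄ : Fin m ⊕ Fin n → ℤ} (h : SameSign e₁ e₂)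
    (h' : SameSign e₃ e₄) (hne : e₂ ≠ e₃) (z : CechCochain K Δ t) :
    cochainShift K Δ t e₃ e₄ (cochainShift K Δ t e₁ e₂ z) = 0 := by
  classical
  refine cochain_ext K Δ fun F hF d => ?_
  simp [cochainCoord_cochainShift K Δ h', cochainCoord_cochainShift K Δ h, hne]

lemma cochain_eq_sum {t : ℕ} (z : CechCochain K Δ t) {s : Finset (Fin m ⊕ Fin n → ℤ)}
    (hs : ∀ e F, cochainCoord K Δ t F e z ≠ 0 → e ∈ s) :
    z = ∑ e ∈ s, cochainShift K Δ t e e z := by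
  classical
  refine cochain_ext K Δ fun F hF d => ?_
  simp only [map_sum, cochainCoord_cochainShift K Δ (SameSign.refl _), Finset.sum_ite_eq']
  split_ifs with h
  · rfl
  · by_contra h'
    exact h (hs d F h')

lemma ringMono_smul_cochainShift {t : ℕ} (c : Fin m ⊕ Fin n →₀ ℕ) (e : Fin m ⊕ Fin n → ℤ)
    (z : CechCochain K Δ t) :
    ringMono K Δ c • cochainShift K Δ t e e z =
      cochainShift K Δ t (e + expDeg c) (e + expDeg c) (ringMono K Δ c • z) := by
  classical
  refine cochain_ext K Δ fun F hF d => ?_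
  obtain ⟨d, rfl⟩ : ∃ d', d = d' + expDeg c := ⟨d - expDeg c, by rw [sub_add_cancel]⟩
  rw [cochainCoord_ringMono_smul K Δ hF, cochainCoord_cochainShift K Δ (SameSign.refl _),
    cochainCoord_cochainShift K Δ (SameSign.refl _), cochainCoord_ringMono_smul K Δ hF]
  by_cases hd : e = d
  · subst hd; simp
  · simp [hd]

lemma ringMono_smul_cochainShift_of_sameSign {t : ℕ} {c : Fin m ⊕ Fin n →₀ ℕ}
    {e : Fin m ⊕ Fin n → ℤ} (h : SameSign e (e + expDeg c)) (z : CechCochain K Δ t) :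
    ringMono K Δ c • cochainShift K Δ t e e z = cochainShift K Δ t e (e + expDeg c) z := by
  classical
  refine cochain_ext K Δ fun F hF d => ?_
  obtain ⟨d, rfl⟩ : ∃ d', d = d' + expDeg c := ⟨d - expDeg c, by rw [sub_add_cancel]⟩
  rw [cochainCoord_ringMono_smul K Δ hF, cochainCoord_cochainShift K Δ (SameSign.refl _),
    cochainCoord_cochainShift K Δ h]
  by_cases hd : e = d
  · subst hd
    by_cases hz : cochainCoord K Δ t F e z = 0
    · simp [hz]
    · simp [(h.admissible_iff F).mp (admissible_of_cochainCoord_ne_zero K Δ hz)]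
  · simp [hd]

/-- In a multidegree `e` with a negative exponent at some `x i` there are no cochains. -/
lemma cochainShift_eq_zero_of_neg {t : ℕ} {e : Fin m ⊕ Fin n → ℤ} {i : Fin m}
    (h : e (Sum.inl i) < 0) (z : CechCochain K Δ t) : cochainShift K Δ t e e z = 0 := by
  classical
  refine cochain_ext K Δ fun F hF d => ?_
  rw [cochainCoord_cochainShift K Δ (SameSign.refl _), map_zero]
  split_ifs
  · by_contra h'
    exact mem_yFace_inl ((admissible_of_cochainCoord_ne_zero K Δ h').1 _ h)
  · rfl

/-- In a multidegree `e` with a positive exponent at some `y j` the Čech complex is exact: the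
components at `F` and `F ∪ {j}` agree, which provides a contracting homotopy. -/
lemma cochainShift_mem_coboundaries_of_pos {i : ℕ} {e : Fin m ⊕ Fin n → ℤ} {j : Fin n}
    (h : 0 < e (Sum.inr j)) {z : CechCochain K Δ i} (hz : cechD K Δ i z = 0) :
    cochainShift K Δ i e e z ∈ coboundaries K Δ i := by
  classical
  have hins : ∀ F : Finset (Fin n), degSupport e ∪ yFace (insert j F) = degSupport e ∪ yFace F := by
    intro F
    ext v
    rcases v with v | v
    · simp
    · by_cases hv : v = j
      · subst hv; simp [h.ne']
      · simp [hv]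
  have hadm : ∀ F : Finset (Fin n), Admissible Δ (insert j F) e → Admissible Δ F e := by
    rintro F ⟨h1, h2⟩
    refine ⟨fun v hv => ?_, hins F ▸ h2⟩
    have := h1 v hv
    rcases v with v | v
    · simp at this
    · have hv' : v ≠ j := by rintro rfl; exact absurd hv h.not_gt
      simpa [hv'] using this
  -- The cocycle condition at `F ∪ {j}`, solved for the coefficient at `F`.
  have hcoc : ∀ F : Finset (Fin n), F.card = i → j ∉ F → IsFace Δ (degSupport e ∪ yFace F) →
      cochainCoord K Δ i F e z = ∑ k ∈ F, (cechSign F k * cechSign (insert j (F.erase k)) j) •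
        cochainCoord K Δ i (insert j (F.erase k)) e z := by
    intro F hF hj hface
    have h1 := cochainCoord_cechD K Δ (t := i) (F := insert j F)
      (by rw [Finset.card_insert_of_notMem hj, hF]) e z
    rw [hz, map_zero, hins, if_pos hface, Finset.sum_insert hj, Finset.erase_insert hj] at h1
    have h2 := congrArg (fun a => cechSign (insert j F) j • a) h1
    simp only [smul_zero, smul_add, Finset.smul_sum, ← mul_smul, cechSign_mul_self, one_smul] at h2
    rw [eq_neg_of_add_eq_zero_left h2.symm, ← Finset.sum_neg_distrib]
    refine Finset.sum_congr rfl fun k hk => ?_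
    rw [cechSign_insert_erase hj hk, neg_smul,
      Finset.erase_insert_of_ne (ne_of_mem_of_not_mem hk hj).symm]
  cases i with
  | zero =>
    change _ = (0 : CechCochain K Δ 0)
    refine cochain_ext K Δ fun F hF d => ?_
    obtain rfl := Finset.card_eq_zero.mp hF
    rw [cochainCoord_cochainShift K Δ (SameSign.refl _), map_zero]
    split_ifs
    · by_contra h'
      refine h' ?_
      rw [hcoc ∅ rfl (Finset.notMem_empty j) (admissible_of_cochainCoord_ne_zero K Δ h').2,
        Finset.sum_empty]
    · rfl
  | succ t =>
    refine ⟨monoCochain K Δ t e fun F => if j ∈ F then 0 else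
      cechSign (insert j F) j • cochainCoord K Δ (t + 1) (insert j F) e z, ?_⟩
    have hw : ∀ F : Finset (Fin n), F.card = t → ∀ d, cochainCoord K Δ t F d
        (monoCochain K Δ t e fun F => if j ∈ F then 0 else
          cechSign (insert j F) j • cochainCoord K Δ (t + 1) (insert j F) e z) =
        if e = d ∧ j ∉ F then
          cechSign (insert j F) j • cochainCoord K Δ (t + 1) (insert j F) e z else 0 := by
      intro F hF d
      rw [cochainCoord_monoCochain K Δ hF]
      by_cases hj : j ∈ F
      · simp [hj]
      · by_cases hz0 : cochainCoord K Δ (t + 1) (insert j F) e z = 0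
        · simp [hz0]
        · simp [hj, hadm F (admissible_of_cochainCoord_ne_zero K Δ hz0)]
    refine cochain_ext K Δ fun F hF d => ?_
    rw [cochainCoord_cechD K Δ hF, cochainCoord_cochainShift K Δ (SameSign.refl _)]
    have hcard : ∀ k ∈ F, (F.erase k).card = t := fun k hk => by
      rw [Finset.card_erase_of_mem hk, hF, Nat.add_sub_cancel]
    rw [Finset.sum_congr rfl fun k hk => by rw [hw _ (hcard k hk)]]
    by_cases hd : e = d
    · subst hd
      simp only [true_and, if_true]
      by_cases hface : IsFace Δ (degSupport e ∪ yFace F)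
      · rw [if_pos hface]
        by_cases hj : j ∈ F
        · rw [Finset.sum_eq_single j]
          · rw [if_pos (Finset.notMem_erase j F), Finset.insert_erase hj, ← mul_smul,
              cechSign_mul_self, one_smul]
          · intro k _ hk
            rw [if_neg (not_not.mpr (Finset.mem_erase.mpr ⟨hk.symm, hj⟩)), smul_zero]
          · exact fun h' => absurd hj h'
        · rw [hcoc F hF hj hface]
          refine Finset.sum_congr rfl fun k hk => ?_
          rw [if_pos (fun h' => hj (Finset.mem_of_mem_erase h')), mul_smul]
      · rw [if_neg hface]
        by_contra h'
        exact hface (admissible_of_cochainCoord_ne_zero K Δ (Ne.symm h')).2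
    · simp [hd]

end Cochains

/-! ### Multigraded components of local cohomology -/

section Cohomology

variable (K : Type*) [Field K] {m n : ℕ} (Δ : PreAbstractSimplicialComplex (Fin m ⊕ Fin n))

lemma cohomologyClass_surjective (i : ℕ) : Function.Surjective (cohomologyClass K Δ i) :=
  Submodule.mkQ_surjective _

lemma cohomologyClass_eq_zero_iff {i : ℕ} {z : LinearMap.ker (cechD K Δ i)} :
    cohomologyClass K Δ i z = 0 ↔ (z : CechCochain K Δ i) ∈ coboundaries K Δ i :=
  (Submodule.Quotient.mk_eq_zero _).trans Iff.rfl

lemma cochainShift_mem_coboundaries {i : ℕ} {e e' : Fin m ⊕ Fin n → ℤ} (h : SameSign e e')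
    {z : CechCochain K Δ i} (hz : z ∈ coboundaries K Δ i) :
    cochainShift K Δ i e e' z ∈ coboundaries K Δ i := by
  cases i with
  | zero =>
    change z = 0 at hz
    rw [hz, map_zero]
    exact Submodule.zero_mem _
  | succ t =>
    obtain ⟨w, rfl⟩ := hz
    exact ⟨cochainShift K Δ t e e' w, cechD_cochainShift K Δ h w⟩

/-- The restriction of `cochainShift` to the cocycles. -/
def cocycleShift (i : ℕ) {e e' : Fin m ⊕ Fin n → ℤ} (h : SameSign e e') :
    LinearMap.ker (cechD K Δ i) →ₗ[K] LinearMap.ker (cechD K Δ i) where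
  toFun z := ⟨cochainShift K Δ i e e' z, by
    rw [LinearMap.mem_ker, cechD_cochainShift K Δ h, LinearMap.mem_ker.mp z.2, map_zero]⟩
  map_add' z z' := Subtype.ext (map_add (cochainShift K Δ i e e') z.1 z'.1)
  map_smul' a z := Subtype.ext (map_smul (cochainShift K Δ i e e') a z.1)

/-- The linear map on cohomology that takes the component of multidegree `e`, and moves it to the
multidegree `e'` with the same sign pattern. -/
def cohomologyShift (i : ℕ) {e e' : Fin m ⊕ Fin n → ℤ} (h : SameSign e e') :
    LocalCohomology K Δ i →ₗ[K] LocalCohomology K Δ i :=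
  (Submodule.liftQ
    (((coboundaries K Δ i).submoduleOf (LinearMap.ker (cechD K Δ i))).restrictScalars K)
    ((cohomologyClass K Δ i).restrictScalars K ∘ₗ cocycleShift K Δ i h) fun z hz => by
      rw [LinearMap.mem_ker, LinearMap.comp_apply, LinearMap.restrictScalars_apply,
        cohomologyClass_eq_zero_iff]
      exact cochainShift_mem_coboundaries K Δ h hz) ∘ₗ
  (Submodule.Quotient.restrictScalarsEquiv K
    ((coboundaries K Δ i).submoduleOf (LinearMap.ker (cechD K Δ i)))).symm.toLinearMap

lemma cohomologyShift_class {i : ℕ} {e e' : Fin m ⊕ Fin n → ℤ} (h : SameSign e e')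
    (z : LinearMap.ker (cechD K Δ i)) :
    cohomologyShift K Δ i h (cohomologyClass K Δ i z) =
      cohomologyClass K Δ i (cocycleShift K Δ i h z) := rfl

/-- The projection of the cohomology to its component of multidegree `e`. -/
def cohomologyProj (i : ℕ) (e : Fin m ⊕ Fin n → ℤ) :
    LocalCohomology K Δ i →ₗ[K] LocalCohomology K Δ i :=
  cohomologyShift K Δ i (SameSign.refl e)

lemma cohomologyShift_comp {i : ℕ} {e e' e'' : Fin m ⊕ Fin n → ℤ} (h : SameSign e e')
    (h' : SameSign e' e'') (ξ : LocalCohomology K Δ i) :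
    cohomologyShift K Δ i h' (cohomologyShift K Δ i h ξ) =
      cohomologyShift K Δ i (h.trans h') ξ := by
  obtain ⟨z, rfl⟩ := cohomologyClass_surjective K Δ i ξ
  rw [cohomologyShift_class, cohomologyShift_class, cohomologyShift_class]
  exact congrArg _ (Subtype.ext (cochainShift_comp K Δ h h' z.1))

lemma cohomologyShift_comp_of_ne {i : ℕ} {e₁ e₂ e₃ e₄ : Fin m ⊕ Fin n → ℤ} (h : SameSign e₁ e₂)
    (h' : SameSign e₃ e₄) (hne : e₂ ≠ e₃) (ξ : LocalCohomology K Δ i) :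
    cohomologyShift K Δ i h' (cohomologyShift K Δ i h ξ) = 0 := by
  obtain ⟨z, rfl⟩ := cohomologyClass_surjective K Δ i ξ
  rw [cohomologyShift_class, cohomologyShift_class, ← map_zero (cohomologyClass K Δ i)]
  exact congrArg _ (Subtype.ext (cochainShift_comp_of_ne K Δ h h' hne z.1))

lemma cohomologyProj_cohomologyProj {i : ℕ} (e : Fin m ⊕ Fin n → ℤ) (ξ : LocalCohomology K Δ i) :
    cohomologyProj K Δ i e (cohomologyProj K Δ i e ξ) = cohomologyProj K Δ i e ξ :=
  cohomologyShift_comp K Δ _ _ ξ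

lemma cohomologyProj_cohomologyProj_of_ne {i : ℕ} {e e' : Fin m ⊕ Fin n → ℤ} (h : e ≠ e')
    (ξ : LocalCohomology K Δ i) :
    cohomologyProj K Δ i e (cohomologyProj K Δ i e' ξ) = 0 :=
  cohomologyShift_comp_of_ne K Δ _ _ h.symm ξ

lemma cohomologyProj_cohomologyShift {i : ℕ} {e e' : Fin m ⊕ Fin n → ℤ} (h : SameSign e e')
    (ξ : LocalCohomology K Δ i) :
    cohomologyProj K Δ i e' (cohomologyShift K Δ i h ξ) = cohomologyShift K Δ i h ξ :=
  cohomologyShift_comp K Δ _ _ ξ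

/-- A cohomology class is the sum of its finitely many multigraded components. -/
lemma exists_eq_sum_cohomologyProj {i : ℕ} (ξ : LocalCohomology K Δ i) :
    ∃ s : Finset (Fin m ⊕ Fin n → ℤ), (∀ e, cohomologyProj K Δ i e ξ ≠ 0 → e ∈ s) ∧
      ξ = ∑ e ∈ s, cohomologyProj K Δ i e ξ := by
  obtain ⟨z, rfl⟩ := cohomologyClass_surjective K Δ i ξ
  have hs : ∀ e F, cochainCoord K Δ i F e z.1 ≠ 0 →
      e ∈ (finite_cochainCoord_ne_zero K Δ z.1).toFinset := fun e F h =>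
    (Set.Finite.mem_toFinset _).mpr ⟨F, h⟩
  refine ⟨(finite_cochainCoord_ne_zero K Δ z.1).toFinset, fun e he => ?_, ?_⟩
  · by_contra h
    refine he ?_
    rw [cohomologyProj, cohomologyShift_class, ← map_zero (cohomologyClass K Δ i)]
    refine congrArg _ (Subtype.ext ?_)
    classical
    refine cochain_ext K Δ fun F _ d => ?_
    refine (cochainCoord_cochainShift K Δ (SameSign.refl e) d z.1).trans ?_
    rw [ZeroMemClass.coe_zero, map_zero]
    split_ifs
    · by_contra h'
      exact h (hs e F h')
    · rfl
  · have : z = ∑ e ∈ (finite_cochainCoord_ne_zero K Δ z.1).toFinset,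
        cocycleShift K Δ i (SameSign.refl e) z := by
      refine Subtype.ext ?_
      rw [AddSubmonoidClass.coe_finsetSum]
      exact cochain_eq_sum K Δ z.1 hs
    conv_lhs => rw [this, map_sum]
    rfl

lemma eq_zero_of_cohomologyProj_eq_zero {i : ℕ} {ξ : LocalCohomology K Δ i}
    (h : ∀ e, cohomologyProj K Δ i e ξ = 0) : ξ = 0 := by
  obtain ⟨s, -, hs⟩ := exists_eq_sum_cohomologyProj K Δ ξ
  rw [hs]
  exact Finset.sum_eq_zero fun e _ => h e

lemma ringMono_smul_cohomologyProj {i : ℕ} (c : Fin m ⊕ Fin n →₀ ℕ) (e : Fin m ⊕ Fin n → ℤ)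
    (ξ : LocalCohomology K Δ i) :
    ringMono K Δ c • cohomologyProj K Δ i e ξ =
      cohomologyProj K Δ i (e + expDeg c) (ringMono K Δ c • ξ) := by
  obtain ⟨z, rfl⟩ := cohomologyClass_surjective K Δ i ξ
  rw [← (cohomologyClass K Δ i).map_smul, cohomologyProj, cohomologyProj, cohomologyShift_class,
    cohomologyShift_class, ← (cohomologyClass K Δ i).map_smul]
  exact congrArg _ (Subtype.ext (ringMono_smul_cochainShift K Δ c e z.1))

lemma ringMono_smul_cohomologyProj_of_sameSign {i : ℕ} {c : Fin m ⊕ Fin n →₀ ℕ}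
    {e : Fin m ⊕ Fin n → ℤ} (h : SameSign e (e + expDeg c)) (ξ : LocalCohomology K Δ i) :
    ringMono K Δ c • cohomologyProj K Δ i e ξ = cohomologyShift K Δ i h ξ := by
  obtain ⟨z, rfl⟩ := cohomologyClass_surjective K Δ i ξ
  rw [cohomologyProj, cohomologyShift_class, cohomologyShift_class,
    ← (cohomologyClass K Δ i).map_smul]
  exact congrArg _ (Subtype.ext (ringMono_smul_cochainShift_of_sameSign K Δ h z.1))

/-- The local cohomology lives in multidegrees with nonnegative `x`-part and nonpositive
`y`-part. -/
lemma sign_of_cohomologyProj_ne_zero {i : ℕ} {e : Fin m ⊕ Fin n → ℤ} {ξ : LocalCohomology K Δ i}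
    (h : cohomologyProj K Δ i e ξ ≠ 0) :
    (∀ a, 0 ≤ e (Sum.inl a)) ∧ ∀ b, e (Sum.inr b) ≤ 0 := by
  obtain ⟨z, rfl⟩ := cohomologyClass_surjective K Δ i ξ
  rw [cohomologyProj, cohomologyShift_class] at h
  refine ⟨fun a => ?_, fun b => ?_⟩
  · by_contra! ha
    refine h ?_
    rw [← map_zero (cohomologyClass K Δ i)]
    exact congrArg _ (Subtype.ext (cochainShift_eq_zero_of_neg K Δ ha z.1))
  · by_contra! hb
    exact h ((cohomologyClass_eq_zero_iff K Δ).mpr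
      (cochainShift_mem_coboundaries_of_pos K Δ hb (LinearMap.mem_ker.mp z.2)))

/-- The component of multidegree `e` of the local cohomology. -/
def cohomologyComponent (i : ℕ) (e : Fin m ⊕ Fin n → ℤ) : Submodule K (LocalCohomology K Δ i) :=
  LinearMap.range (cohomologyProj K Δ i e)

lemma mem_cohomologyComponent {i : ℕ} {e : Fin m ⊕ Fin n → ℤ} {ξ : LocalCohomology K Δ i} :
    ξ ∈ cohomologyComponent K Δ i e ↔ cohomologyProj K Δ i e ξ = ξ := by
  refine ⟨?_, fun h => ⟨ξ, h⟩⟩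
  rintro ⟨η, rfl⟩
  exact cohomologyProj_cohomologyProj K Δ e η

instance finite_cohomologyComponent (i : ℕ) (e : Fin m ⊕ Fin n → ℤ) :
    Module.Finite K (cohomologyComponent K Δ i e) := by
  classical
  let ψ : LinearMap.ker (cechD K Δ i) →ₗ[K] (Finset (Fin n) → K) :=
    LinearMap.pi fun F => cochainCoord K Δ i F e ∘ₗ
      (LinearMap.ker (cechD K Δ i)).subtype.restrictScalars K
  let W : Submodule K (LinearMap.ker (cechD K Δ i)) :=
    LinearMap.range (cocycleShift K Δ i (SameSign.refl e))
  have hinj : Function.Injective (ψ ∘ₗ W.subtype) := by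
    refine (injective_iff_map_eq_zero _).mpr ?_
    rintro ⟨_, z, rfl⟩ hz
    refine Subtype.ext (Subtype.ext (cochain_ext K Δ fun F hF d => ?_))
    have h1 : cochainCoord K Δ i F e (cochainShift K Δ i e e z.1) = 0 := congrFun hz F
    rw [cochainCoord_cochainShift K Δ (SameSign.refl e), if_pos rfl] at h1
    refine (cochainCoord_cochainShift K Δ (SameSign.refl e) d z.1).trans ?_
    rw [h1, ite_self]
    exact (map_zero _).symm
  have : Module.Finite K W := Module.Finite.of_injective _ hinj
  have hle : cohomologyComponent K Δ i e =
      W.map ((cohomologyClass K Δ i).restrictScalars K) := by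
    refine le_antisymm ?_ ?_
    · rintro _ ⟨ξ, rfl⟩
      obtain ⟨z, rfl⟩ := cohomologyClass_surjective K Δ i ξ
      exact ⟨_, ⟨z, rfl⟩, rfl⟩
    · rintro _ ⟨_, ⟨z, rfl⟩, rfl⟩
      exact ⟨cohomologyClass K Δ i z, rfl⟩
  rw [hle]
  infer_instance

/-- The dimension of a multigraded component depends only on the sign pattern of the degree. -/
lemma finrank_cohomologyComponent_eq {i : ℕ} {e e' : Fin m ⊕ Fin n → ℤ} (h : SameSign e e') :
    Module.finrank K (cohomologyComponent K Δ i e) =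
      Module.finrank K (cohomologyComponent K Δ i e') := by
  have key : ∀ {e e' : Fin m ⊕ Fin n → ℤ}, SameSign e e' →
      Module.finrank K (cohomologyComponent K Δ i e) ≤
        Module.finrank K (cohomologyComponent K Δ i e') := by
    intro e e' h
    refine LinearMap.finrank_le_finrank_of_injective
      (f := (cohomologyShift K Δ i h).restrict (p := cohomologyComponent K Δ i e)
        (q := cohomologyComponent K Δ i e')
        fun ξ _ => ⟨_, cohomologyProj_cohomologyShift K Δ h ξ⟩) ?_
    rw [← LinearMap.ker_eq_bot, LinearMap.ker_eq_bot']
    rintro ⟨ξ, hξ⟩ h0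
    refine Subtype.ext ?_
    have h1 : cohomologyShift K Δ i h ξ = 0 := congrArg Subtype.val h0
    have h2 := cohomologyShift_comp K Δ h h.symm ξ
    rw [h1, map_zero] at h2
    exact ((mem_cohomologyComponent K Δ).mp hξ).symm.trans h2.symm
  exact le_antisymm (key h) (key h.symm)

/-! ### The bigraded pieces -/

/-- The total degree in the variables `x`. -/
def xTotal (e : Fin m ⊕ Fin n → ℤ) : ℤ := ∑ a, e (Sum.inl a)

/-- The total degree in the variables `y`. -/
def yTotal (e : Fin m ⊕ Fin n → ℤ) : ℤ := ∑ b, e (Sum.inr b)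

lemma yTotal_add (e e' : Fin m ⊕ Fin n → ℤ) : yTotal (e + e') = yTotal e + yTotal e' := by
  simp [yTotal, Finset.sum_add_distrib]

lemma xTotal_sub_nsmul_yExp (c : Fin m ⊕ Fin n →₀ ℕ) (l : ℕ) (F : Finset (Fin n)) :
    xTotal (expDeg c - l • expDeg (yExp F)) = xTotal (expDeg c) := by
  simp [xTotal, yExp_apply]

lemma yTotal_sub_nsmul_yExp (c : Fin m ⊕ Fin n →₀ ℕ) (l : ℕ) (F : Finset (Fin n)) :
    yTotal (expDeg c - l • expDeg (yExp F)) = yTotal (expDeg c) - l * F.card := by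
  simp [yTotal, yExp_apply, Finset.sum_ite_mem, mul_comm]

lemma weight_bidegree (c : Fin m ⊕ Fin n →₀ ℕ) :
    (((Finsupp.weight (bidegree m n) c).1 : ℕ) : ℤ) = xTotal (expDeg c) ∧
      (((Finsupp.weight (bidegree m n) c).2 : ℕ) : ℤ) = yTotal (expDeg c) := by
  rw [Finsupp.weight_apply, Finsupp.sum_fintype _ _ (by simp)]
  simp [Fintype.sum_sum_type, bidegree, xTotal, yTotal, Prod.fst_sum, Prod.snd_sum]

lemma weight_yDegree (c : Fin m ⊕ Fin n →₀ ℕ) :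
    ((Finsupp.weight (yDegree m n) c : ℕ) : ℤ) = yTotal (expDeg c) := by
  rw [Finsupp.weight_apply, Finsupp.sum_fintype _ _ (by simp)]
  simp [Fintype.sum_sum_type, yDegree, bidegree, yTotal]

lemma laurentMono_mem_locPiece (F : Finset (Fin n)) (e : Fin m ⊕ Fin n → ℤ) :
    laurentMono K Δ F e ∈ locPiece K Δ F (xTotal e) (yTotal e) := by
  by_cases h : Admissible Δ F e
  · obtain ⟨c, l, rfl⟩ := exists_expDeg_sub h.1
    rw [laurentMono_of_eq K Δ rfl, xTotal_sub_nsmul_yExp, yTotal_sub_nsmul_yExp]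
    refine Submodule.subset_span ⟨(Finsupp.weight (bidegree m n) c).1,
      (Finsupp.weight (bidegree m n) c).2, l, ringMono K Δ c, ?_, (weight_bidegree c).1, ?_, rfl⟩
    · exact ⟨_, MvPolynomial.isWeightedHomogeneous_monomial _ _ _ rfl, rfl⟩
    · rw [(weight_bidegree c).2]
  · rw [laurentMono_eq_zero K Δ h]
    exact Submodule.zero_mem _

lemma mem_locPiece_iff {F : Finset (Fin n)} {k j : ℤ} {z : CechLoc K Δ F} :
    z ∈ locPiece K Δ F k j ↔ ∀ e, coord K Δ F e z ≠ 0 → xTotal e = k ∧ yTotal e = j := by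
  classical
  constructor
  · intro hz
    induction hz using Submodule.span_induction with
    | mem x hx =>
      obtain ⟨p, q, l, r, ⟨f, hf, rfl⟩, rfl, rfl, rfl⟩ := hx
      intro e he
      have hsum : (Localization.mk ((Ideal.Quotient.mkₐ K (stanleyReisnerIdeal K Δ)).toLinearMap f)
          ⟨yProd K Δ F ^ l, pow_mem (Submonoid.mem_powers _) l⟩ : CechLoc K Δ F) =
          ∑ c ∈ f.support, f.coeff c • monoFrac K Δ F c l := by
        conv_lhs => rw [f.as_sum, map_sum, Localization.mk_sum]
        refine Finset.sum_congr rfl fun c _ => ?_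
        rw [monoFrac, Localization.smul_mk, ringMono, ← map_smul, MvPolynomial.smul_monomial,
          smul_eq_mul, mul_one]
        rfl
      rw [hsum, map_sum] at he
      obtain ⟨c, hc, hne⟩ := Finset.exists_ne_zero_of_sum_ne_zero he
      rw [map_smul, coord_monoFrac] at hne
      have hce : expDeg c - l • expDeg (yExp F) = e := by
        by_contra h
        exact hne (by rw [if_neg fun h' => h h'.2, smul_zero])
      have hw : Finsupp.weight (bidegree m n) c = (p, q) :=
        hf (MvPolynomial.mem_support_iff.mp hc)
      have h2 := weight_bidegree c
      rw [hw] at h2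
      rw [← hce, xTotal_sub_nsmul_yExp, yTotal_sub_nsmul_yExp, ← h2.1, ← h2.2]
      exact ⟨rfl, rfl⟩
    | zero => intro e he; exact absurd (map_zero _) he
    | add x y _ _ hx hy =>
      intro e he
      by_cases hxe : coord K Δ F e x = 0
      · exact hy e fun h => he (by rw [map_add, hxe, h, add_zero])
      · exact hx e hxe
    | smul a x _ hx =>
      intro e he
      exact hx e fun h => he (by rw [map_smul, h, smul_zero])
  · intro h
    rw [eq_sum_coord K Δ F z]
    refine finsum_induction (· ∈ locPiece K Δ F k j) (Submodule.zero_mem _)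
      (fun _ _ hx hy => Submodule.add_mem _ hx hy) ?_
    intro e
    by_cases he : coord K Δ F e z = 0
    · rw [he, zero_smul]
      exact Submodule.zero_mem _
    · obtain ⟨rfl, rfl⟩ := h e he
      exact Submodule.smul_mem _ _ (laurentMono_mem_locPiece K Δ F e)

lemma mem_cochainPiece_iff {t : ℕ} {k j : ℤ} {z : CechCochain K Δ t} :
    z ∈ cochainPiece K Δ t k j ↔
      ∀ e F, cochainCoord K Δ t F e z ≠ 0 → xTotal e = k ∧ yTotal e = j := by
  rw [cochainPiece, Submodule.mem_pi]
  simp only [Set.mem_univ, true_imp_iff, mem_locPiece_iff]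
  constructor
  · intro h e F he
    by_cases hF : F.card = t
    · rw [cochainCoord_of_card K Δ hF] at he
      exact h ⟨F, hF⟩ e he
    · exact absurd (cochainCoord_of_card_ne K Δ hF e z) he
  · intro h F e he
    rw [← cochainCoord_of_card K Δ F.2] at he
    exact h e F.1 he

lemma mem_cohomologyPiece_iff {i : ℕ} {k j : ℤ} {ξ : LocalCohomology K Δ i} :
    ξ ∈ cohomologyPiece K Δ i k j ↔
      ∀ e, cohomologyProj K Δ i e ξ ≠ 0 → xTotal e = k ∧ yTotal e = j := by
  classical
  constructor
  · rintro ⟨z, hz, rfl⟩ e he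
    by_contra hne
    refine he ?_
    change cohomologyProj K Δ i e (cohomologyClass K Δ i z) = 0
    rw [cohomologyProj, cohomologyShift_class, ← map_zero (cohomologyClass K Δ i)]
    refine congrArg _ (Subtype.ext (cochain_ext K Δ fun F _ d => ?_))
    refine (cochainCoord_cochainShift K Δ (SameSign.refl e) d z.1).trans ?_
    rw [ZeroMemClass.coe_zero, map_zero]
    split_ifs
    · by_contra h'
      exact hne ((mem_cochainPiece_iff K Δ).mp hz e F h')
    · rfl
  · intro h
    obtain ⟨s, -, hs⟩ := exists_eq_sum_cohomologyProj K Δ ξ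
    rw [hs]
    refine Submodule.sum_mem _ fun e _ => ?_
    by_cases he : cohomologyProj K Δ i e ξ = 0
    · rw [he]; exact Submodule.zero_mem _
    · obtain ⟨rfl, rfl⟩ := h e he
      obtain ⟨z, rfl⟩ := cohomologyClass_surjective K Δ i ξ
      refine ⟨cocycleShift K Δ i (SameSign.refl e) z, ?_, rfl⟩
      refine (mem_cochainPiece_iff K Δ).mpr fun d F hd => ?_
      have h2 : (if e = d then cochainCoord K Δ i F e z.1 else 0) ≠ 0 := by
        rw [← cochainCoord_cochainShift K Δ (SameSign.refl e) d z.1]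
        exact hd
      have hed : e = d := by
        by_contra h3
        exact h2 (if_neg h3)
      exact hed ▸ ⟨rfl, rfl⟩

end Cohomology

/-! ### Counting multidegrees with given support -/

section Counting

/-- The number of vectors of natural numbers with support `A` and sum `k`. -/
def supportCount {N : ℕ} (A : Finset (Fin N)) (k : ℕ) : ℕ :=
  ((Finset.finsuppAntidiag Finset.univ k).filter fun a : Fin N →₀ ℕ => a.support = A).card

/-- The power series `X + X ^ 2 + ⋯ = X / (1 - X)`. -/
def geomTail : PowerSeries ℚ := PowerSeries.mk fun k => if k = 0 then 0 else 1

lemma geomTail_eq : geomTail = PowerSeries.X * PowerSeries.mk 1 := by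
  ext k
  cases k with
  | zero => simp [geomTail]
  | succ k => rw [PowerSeries.coeff_succ_X_mul]; simp [geomTail]

lemma geomTail_mul_one_sub_X : geomTail * (1 - PowerSeries.X) = PowerSeries.X := by
  rw [geomTail_eq, mul_assoc, PowerSeries.mk_one_mul_one_sub_eq_one, mul_one]

lemma coeff_geomTail_pow_card {N : ℕ} (A : Finset (Fin N)) (k : ℕ) :
    PowerSeries.coeff k (geomTail ^ A.card) = (supportCount A k : ℚ) := by
  have h1 : geomTail ^ A.card = ∏ i : Fin N, if i ∈ A then geomTail else 1 := by
    rw [Finset.prod_ite_mem, Finset.univ_inter, Finset.prod_const]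
  rw [h1, PowerSeries.coeff_prod, supportCount, Finset.card_filter, Nat.cast_sum]
  refine Finset.sum_congr rfl fun a _ => ?_
  have h2 : ∀ i, PowerSeries.coeff (a i) (if i ∈ A then geomTail else 1) =
      if (a i ≠ 0 ↔ i ∈ A) then 1 else 0 := by
    intro i
    by_cases hi : i ∈ A <;> by_cases ha : a i = 0 <;>
      simp [hi, ha, geomTail, PowerSeries.coeff_one]
  rw [Finset.prod_congr rfl fun i _ => h2 i, Finset.prod_ite_zero]
  simp only [Finset.mem_univ, true_imp_iff, Finset.prod_const_one, Nat.cast_ite, Nat.cast_one,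
    Nat.cast_zero, Finset.ext_iff, Finsupp.mem_support_iff]

lemma geomTail_pow_mul_one_sub_X_pow {d m : ℕ} (h : d ≤ m) :
    geomTail ^ d * (1 - PowerSeries.X) ^ m =
      PowerSeries.X ^ d * (1 - PowerSeries.X) ^ (m - d) := by
  conv_lhs => rw [← Nat.add_sub_of_le h, pow_add, ← mul_assoc, ← mul_pow, geomTail_mul_one_sub_X]

lemma coeff_succ_geomTail_pow_succ (g N : ℕ) :
    PowerSeries.coeff (N + 1) (geomTail ^ (g + 1)) = (N.choose g : ℚ) := by
  have h : (PowerSeries.mk 1 : PowerSeries ℚ) ^ (g + 1) =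
      PowerSeries.mk fun n => (Nat.choose (g + n) g : ℚ) :=
    PowerSeries.mk_one_pow_eq_mk_choose_add ℚ g
  rw [geomTail_eq, mul_pow, h, PowerSeries.coeff_X_pow_mul']
  by_cases hg : g ≤ N
  · rw [if_pos (by omega), PowerSeries.coeff_mk, Nat.add_sub_add_right, Nat.add_sub_cancel' hg]
  · rw [if_neg (by omega), Nat.choose_eq_zero_of_lt (by omega), Nat.cast_zero]

/-- The polynomial in `j` that counts, for `j < 0`, the vectors of negative integers of length `g`
with sum `j`. It is `0` for `g = 0`, and `binom (-j - 1, g - 1)` otherwise. -/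
def negCountPoly : ℕ → ℚ[X]
  | 0 => 0
  | g + 1 => C ((g.factorial : ℚ)⁻¹) * (descPochhammer ℚ g).comp (-X - 1)

lemma eval_negCountPoly (g N : ℕ) :
    (negCountPoly (g + 1)).eval (-((N + 1 : ℕ) : ℚ)) = N.choose g := by
  rw [negCountPoly, eval_mul, eval_C, eval_comp]
  have : (-X - 1 : ℚ[X]).eval (-((N + 1 : ℕ) : ℚ)) = N := by simp
  rw [this, descPochhammer_eval_eq_descFactorial, Nat.descFactorial_eq_factorial_mul_choose]
  push_cast
  rw [inv_mul_cancel_left₀ (Nat.cast_ne_zero.mpr g.factorial_ne_zero)]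

lemma eval_negCountPoly_card {n : ℕ} (G : Finset (Fin n)) (N : ℕ) :
    (negCountPoly G.card).eval (-((N + 1 : ℕ) : ℚ)) = supportCount G (N + 1) := by
  rw [← coeff_geomTail_pow_card]
  cases G.card with
  | zero => simp [negCountPoly, PowerSeries.coeff_one]
  | succ g => rw [eval_negCountPoly, coeff_succ_geomTail_pow_succ]

lemma degree_negCountPoly_lt {g n : ℕ} (h : g ≤ n) : (negCountPoly g).degree < n := by
  cases g with
  | zero => rw [negCountPoly, degree_zero]; exact WithBot.bot_lt_coe n
  | succ g =>
    refine lt_of_le_of_lt degree_le_natDegree (Nat.cast_lt.mpr (lt_of_le_of_lt ?_ h))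
    refine (natDegree_C_mul_le _ _).trans (natDegree_comp_le.trans ?_)
    have : (-X - 1 : ℚ[X]).natDegree ≤ 1 := by compute_degree
    calc _ ≤ g * 1 := Nat.mul_le_mul (by rw [descPochhammer_natDegree]) this
      _ = g := mul_one g

end Counting

/-! ### The order of vanishing at one -/

section RootMultiplicity

variable {S : Type*} [CommRing S]

/-- The polynomial `∑ γ d * X ^ d * (1 - X) ^ (m - d)`. -/
def bernsteinSum (m : ℕ) (γ : ℕ → S) : S[X] :=
  ∑ d ∈ Finset.range (m + 1), C (γ d) * (X ^ d * (1 - X) ^ (m - d))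

lemma natDegree_bernsteinSum_le (m : ℕ) (γ : ℕ → S) : (bernsteinSum m γ).natDegree ≤ m := by
  refine natDegree_sum_le_of_forall_le _ _ fun d hd => ?_
  have hd' : d ≤ m := Nat.lt_succ_iff.mp (Finset.mem_range.mp hd)
  have h1 : (1 - X : S[X]).natDegree ≤ 1 := by compute_degree
  refine (natDegree_C_mul_le _ _).trans (natDegree_mul_le.trans ?_)
  have h2 := natDegree_X_pow_le (R := S) d
  have h3 : ((1 - X : S[X]) ^ (m - d)).natDegree ≤ (m - d) * 1 :=
    natDegree_pow_le.trans (Nat.mul_le_mul_left _ h1)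
  omega

lemma map_bernsteinSum {T : Type*} [CommRing T] (f : S →+* T) (m : ℕ) (γ : ℕ → S) :
    (bernsteinSum m γ).map f = bernsteinSum m fun d => f (γ d) := by
  simp [bernsteinSum, Polynomial.map_sum]

lemma bernsteinSum_eq_zero {m : ℕ} {γ : ℕ → S} (h : ∀ d ≤ m, γ d = 0) : bernsteinSum m γ = 0 :=
  Finset.sum_eq_zero fun d hd => by
    rw [h d (Nat.lt_succ_iff.mp (Finset.mem_range.mp hd)), C_0, zero_mul]

lemma rootMultiplicity_bernsteinSum [IsDomain S] {m D : ℕ} {γ : ℕ → S} (hD : D ≤ m)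
    (h0 : γ D ≠ 0) (h : ∀ d ≤ m, D < d → γ d = 0) :
    bernsteinSum m γ ≠ 0 ∧ (bernsteinSum m γ).rootMultiplicity 1 = m - D := by
  -- Only the terms with `d ≤ D` remain, and all are divisible by `(1 - X) ^ (m - D)`.
  have h1 : bernsteinSum m γ = (X - C 1) ^ (m - D) * ((-1) ^ (m - D) * bernsteinSum D γ) := by
    rw [← mul_assoc, ← mul_pow]
    have : (X - C 1) * (-1) = (1 - X : S[X]) := by rw [C_1]; ring
    rw [this, bernsteinSum, bernsteinSum, Finset.mul_sum]
    symm
    rw [← Finset.sum_subset (Finset.range_subset_range.mpr (Nat.succ_le_succ hD))]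
    · refine Finset.sum_congr rfl fun d hd => ?_
      have hd' : d ≤ D := Nat.lt_succ_iff.mp (Finset.mem_range.mp hd)
      rw [show m - d = (m - D) + (D - d) by omega, pow_add]
      ring
    · intro d hd hd'
      rw [Finset.mem_range] at hd hd'
      rw [h d (by omega) (by omega), C_0, zero_mul]
  have h2 : ((-1) ^ (m - D) * bernsteinSum D γ).eval 1 = (-1) ^ (m - D) * γ D := by
    rw [eval_mul, bernsteinSum, eval_finsetSum, Finset.sum_eq_single D]
    · simp
    · intro d hd hne
      have : D - d ≠ 0 := by rw [Finset.mem_range] at hd; omega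
      simp [this]
    · simp
  have h3 : ((-1) ^ (m - D) * bernsteinSum D γ).eval 1 ≠ 0 := by
    rw [h2]
    exact mul_ne_zero (pow_ne_zero _ (neg_ne_zero.mpr one_ne_zero)) h0
  have h4 : (-1) ^ (m - D) * bernsteinSum D γ ≠ 0 := fun h => h3 (by rw [h, eval_zero])
  have h5 : bernsteinSum m γ ≠ 0 := by
    rw [h1]
    exact mul_ne_zero (pow_ne_zero _ (X_sub_C_ne_zero 1)) h4
  refine ⟨h5, ?_⟩
  rw [h1] at h5 ⊢
  rw [rootMultiplicity_mul h5, rootMultiplicity_X_sub_C_pow, rootMultiplicity_eq_zero h3, add_zero]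

end RootMultiplicity

/-! ### The Hilbert series -/

/-- The multidegree with `x`-part `a` and `y`-part `-b`. -/
def localDegree {m n : ℕ} (a : Fin m →₀ ℕ) (b : Fin n →₀ ℕ) : Fin m ⊕ Fin n → ℤ :=
  Sum.elim (fun i => a i) fun j => -b j

lemma localDegree_injective {m n : ℕ} :
    Function.Injective fun p : (Fin m →₀ ℕ) × (Fin n →₀ ℕ) => localDegree p.1 p.2 := by
  rintro ⟨a, b⟩ ⟨a', b'⟩ h
  refine Prod.ext (Finsupp.ext fun i => ?_) (Finsupp.ext fun j => ?_)
  · simpa [localDegree] using congrFun h (Sum.inl i)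
  · simpa [localDegree] using congrFun h (Sum.inr j)

lemma xTotal_localDegree {m n : ℕ} (a : Fin m →₀ ℕ) (b : Fin n →₀ ℕ) :
    xTotal (localDegree a b) = ((∑ i, a i : ℕ) : ℤ) := by
  simp [xTotal, localDegree]

lemma yTotal_localDegree {m n : ℕ} (a : Fin m →₀ ℕ) (b : Fin n →₀ ℕ) :
    yTotal (localDegree a b) = -((∑ j, b j : ℕ) : ℤ) := by
  simp [yTotal, localDegree]

lemma sameSign_localDegree {m n : ℕ} {a a' : Fin m →₀ ℕ} {b b' : Fin n →₀ ℕ}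
    (ha : a.support = a'.support) (hb : b.support = b'.support) :
    SameSign (localDegree a b) (localDegree a' b') := by
  have key : ∀ {N : ℕ} {c c' : Fin N →₀ ℕ}, c.support = c'.support → ∀ v,
      SignType.sign (c v : ℤ) = SignType.sign (c' v : ℤ) := by
    intro N c c' h v
    by_cases hv : v ∈ c.support
    · have hv' := h ▸ hv
      rw [Finsupp.mem_support_iff] at hv hv'
      rw [sign_pos (by positivity), sign_pos (by positivity)]
    · have hv' := h ▸ hv
      rw [Finsupp.notMem_support_iff] at hv hv'
      rw [hv, hv']
  rintro (v | v)
  · exact key ha v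
  · change SignType.sign (-(b v : ℤ)) = SignType.sign (-(b' v : ℤ))
    rw [Left.sign_neg, Left.sign_neg, key hb]

/-- The `0`-`1`-vector with support `A`. -/
def indicatorVec {N : ℕ} (A : Finset (Fin N)) : Fin N →₀ ℕ := Finsupp.indicator A fun _ _ => 1

lemma indicatorVec_apply {N : ℕ} (A : Finset (Fin N)) (v : Fin N) :
    indicatorVec A v = if v ∈ A then 1 else 0 := by
  simp [indicatorVec, Finsupp.indicator_apply]

lemma support_indicatorVec {N : ℕ} (A : Finset (Fin N)) : (indicatorVec A).support = A := by
  ext v; simp [indicatorVec_apply]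

section Dimension

variable (K : Type*) [Field K] {m n : ℕ} (Δ : PreAbstractSimplicialComplex (Fin m ⊕ Fin n))

/-- The dimension of the components of the local cohomology in the multidegrees with positive
`x`-part at `A`, negative `y`-part at `G`, and value `0` elsewhere. -/
def signDim (i : ℕ) (A : Finset (Fin m)) (G : Finset (Fin n)) : ℕ :=
  Module.finrank K (cohomologyComponent K Δ i (localDegree (indicatorVec A) (indicatorVec G)))

lemma finrank_cohomologyComponent (i : ℕ) (a : Fin m →₀ ℕ) (b : Fin n →₀ ℕ) :
    Module.finrank K (cohomologyComponent K Δ i (localDegree a b)) =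
      signDim K Δ i a.support b.support :=
  finrank_cohomologyComponent_eq K Δ (sameSign_localDegree (support_indicatorVec _).symm
    (support_indicatorVec _).symm)

lemma exists_eq_localDegree {i : ℕ} {e : Fin m ⊕ Fin n → ℤ} {ξ : LocalCohomology K Δ i}
    (h : cohomologyProj K Δ i e ξ ≠ 0) : ∃ a b, e = localDegree a b := by
  obtain ⟨h1, h2⟩ := sign_of_cohomologyProj_ne_zero K Δ h
  refine ⟨Finsupp.equivFunOnFinite.symm fun i => (e (Sum.inl i)).toNat,
    Finsupp.equivFunOnFinite.symm fun j => (-e (Sum.inr j)).toNat, ?_⟩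
  funext v
  rcases v with v | v
  · have := h1 v
    simp only [localDegree, Sum.elim_inl, Finsupp.coe_equivFunOnFinite_symm]
    omega
  · have := h2 v
    simp only [localDegree, Sum.elim_inr, Finsupp.coe_equivFunOnFinite_symm]
    omega

/-- The multidegrees with nonnegative `x`-part of sum `k` and nonpositive `y`-part of sum `-l`. -/
def localDegrees (m n k l : ℕ) : Finset (Fin m ⊕ Fin n → ℤ) :=
  (Finset.finsuppAntidiag Finset.univ k ×ˢ Finset.finsuppAntidiag Finset.univ l).map
    ⟨fun p : (Fin m →₀ ℕ) × (Fin n →₀ ℕ) => localDegree p.1 p.2, localDegree_injective⟩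

lemma localDegree_mem_localDegrees {k l : ℕ} {a : Fin m →₀ ℕ} {b : Fin n →₀ ℕ} :
    localDegree a b ∈ localDegrees m n k l ↔ ∑ i, a i = k ∧ ∑ j, b j = l := by
  have := (Finset.mem_map' (s := Finset.finsuppAntidiag Finset.univ k ×ˢ
    Finset.finsuppAntidiag Finset.univ l) ⟨fun p : (Fin m →₀ ℕ) × (Fin n →₀ ℕ) =>
      localDegree p.1 p.2, localDegree_injective⟩ (a := (a, b)))
  rw [localDegrees]
  refine this.trans ?_
  simp

lemma mem_localDegrees_of_cohomologyProj_ne_zero {i : ℕ} {e : Fin m ⊕ Fin n → ℤ}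
    {ξ : LocalCohomology K Δ i} (h : cohomologyProj K Δ i e ξ ≠ 0) :
    e ∈ localDegrees m n (xTotal e).toNat (-yTotal e).toNat := by
  obtain ⟨a, b, rfl⟩ := exists_eq_localDegree K Δ h
  rw [localDegree_mem_localDegrees, xTotal_localDegree, yTotal_localDegree]
  omega

/-- The components of a cohomology class in the multidegrees in `s`. -/
def componentsMap (i : ℕ) (s : Finset (Fin m ⊕ Fin n → ℤ)) :
    LocalCohomology K Δ i →ₗ[K] (e : s) → cohomologyComponent K Δ i e :=
  LinearMap.pi fun e => (cohomologyProj K Δ i e).rangeRestrict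

lemma componentsMap_injective {i : ℕ} {P : Submodule K (LocalCohomology K Δ i)}
    {s : Finset (Fin m ⊕ Fin n → ℤ)}
    (h : ∀ ξ ∈ P, ∀ e, cohomologyProj K Δ i e ξ ≠ 0 → e ∈ s) :
    Function.Injective (componentsMap K Δ i s ∘ₗ P.subtype) := by
  refine (injective_iff_map_eq_zero _).mpr ?_
  rintro ⟨ξ, hξ⟩ h0
  refine Subtype.ext (eq_zero_of_cohomologyProj_eq_zero K Δ fun e => ?_)
  by_contra he
  exact he (congrArg Subtype.val (congrFun h0 ⟨e, h ξ hξ e he⟩))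

lemma finrank_eq_sum_cohomologyComponent {i : ℕ} {P : Submodule K (LocalCohomology K Δ i)}
    {s : Finset (Fin m ⊕ Fin n → ℤ)}
    (h : ∀ ξ, ξ ∈ P ↔ ∀ e, cohomologyProj K Δ i e ξ ≠ 0 → e ∈ s) :
    Module.finrank K P = ∑ e ∈ s, Module.finrank K (cohomologyComponent K Δ i e) := by
  classical
  have hbij : Function.Bijective (componentsMap K Δ i s ∘ₗ P.subtype) := by
    refine ⟨componentsMap_injective K Δ fun ξ hξ => (h ξ).mp hξ, fun η => ?_⟩
    have hη : ∀ d, cohomologyProj K Δ i d (∑ e : s, (η e : LocalCohomology K Δ i)) =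
        if hd : d ∈ s then (η ⟨d, hd⟩ : LocalCohomology K Δ i) else 0 := by
      intro d
      have hterm : ∀ e : s, cohomologyProj K Δ i d (η e) =
          if d = e then (η e : LocalCohomology K Δ i) else 0 := by
        intro e
        rw [← (mem_cohomologyComponent K Δ).mp (η e).2]
        split_ifs with hd
        · subst hd
          exact cohomologyProj_cohomologyProj K Δ _ _
        · exact cohomologyProj_cohomologyProj_of_ne K Δ hd _
      rw [map_sum, Finset.sum_congr rfl fun e _ => hterm e]
      split_ifs with hd
      · rw [Finset.sum_eq_single ⟨d, hd⟩]
        · rw [if_pos rfl]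
        · intro e _ hne
          exact if_neg fun h' => hne (Subtype.ext h'.symm)
        · exact fun h' => absurd (Finset.mem_univ _) h'
      · exact Finset.sum_eq_zero fun e _ => if_neg fun h' : d = e => hd (h' ▸ e.2)
    refine ⟨⟨∑ e : s, (η e : LocalCohomology K Δ i), (h _).mpr fun d hd => ?_⟩, ?_⟩
    · by_contra hds
      exact hd ((hη d).trans (dif_neg hds))
    · funext e
      exact Subtype.ext ((hη e).trans (dif_pos e.2))
  rw [(LinearEquiv.ofBijective _ hbij).finrank_eq, Module.finrank_pi_fintype,
    Finset.sum_coe_sort s fun e => Module.finrank K (cohomologyComponent K Δ i e)]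

lemma finite_cohomologyPiece (i : ℕ) (k j : ℤ) : Module.Finite K (cohomologyPiece K Δ i k j) := by
  refine Module.Finite.of_injective _ (componentsMap_injective K Δ
    (P := cohomologyPiece K Δ i k j) (s := localDegrees m n k.toNat (-j).toNat)
    fun ξ hξ e he => ?_)
  obtain ⟨rfl, rfl⟩ := (mem_cohomologyPiece_iff K Δ).mp hξ e he
  exact mem_localDegrees_of_cohomologyProj_ne_zero K Δ he

lemma finrank_cohomologyPiece (i k l : ℕ) :
    Module.finrank K (cohomologyPiece K Δ i k (-(l : ℤ))) =
      ∑ A : Finset (Fin m), ∑ G : Finset (Fin n),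
        signDim K Δ i A G * (supportCount A k * supportCount G l) := by
  classical
  rw [finrank_eq_sum_cohomologyComponent K Δ (s := localDegrees m n k l), localDegrees,
    Finset.sum_map]
  · simp only [Function.Embedding.coeFn_mk, finrank_cohomologyComponent]
    rw [Finset.sum_product]
    rw [← Finset.sum_fiberwise (Finset.finsuppAntidiag Finset.univ k)
      fun a : Fin m →₀ ℕ => a.support]
    refine Finset.sum_congr rfl fun A _ => ?_
    have h1 : ∀ a ∈ (Finset.finsuppAntidiag Finset.univ k).filter
        (fun a : Fin m →₀ ℕ => a.support = A),
        (∑ b ∈ Finset.finsuppAntidiag Finset.univ l, signDim K Δ i a.support b.support) =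
        ∑ G : Finset (Fin n), signDim K Δ i A G * supportCount G l := by
      intro a ha
      rw [(Finset.mem_filter.mp ha).2, ← Finset.sum_fiberwise
        (Finset.finsuppAntidiag Finset.univ l) fun b : Fin n →₀ ℕ => b.support]
      refine Finset.sum_congr rfl fun G _ => ?_
      rw [Finset.sum_congr rfl fun b hb => by rw [(Finset.mem_filter.mp hb).2],
        Finset.sum_const, smul_eq_mul, mul_comm, supportCount]
    rw [Finset.sum_congr rfl h1, Finset.sum_const, smul_eq_mul, Finset.mul_sum]
    refine Finset.sum_congr rfl fun G _ => ?_
    unfold supportCount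
    ring
  · intro ξ
    rw [mem_cohomologyPiece_iff]
    refine forall_congr' fun e => forall_congr' fun he => ?_
    obtain ⟨a, b, rfl⟩ := exists_eq_localDegree K Δ he
    rw [localDegree_mem_localDegrees, xTotal_localDegree, yTotal_localDegree]
    omega

/-- The polynomial in `j` that gives, for `j < 0`, the multiplicity of `(s / (1 - s)) ^ d` in the
Hilbert series of the component of `y`-degree `j`. -/
def hilbertCoeff (i d : ℕ) : ℚ[X] :=
  ∑ A ∈ Finset.powersetCard d (Finset.univ : Finset (Fin m)), ∑ G : Finset (Fin n),
    C (signDim K Δ i A G : ℚ) * negCountPoly G.card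

lemma degree_hilbertCoeff_lt (i d : ℕ) : (hilbertCoeff K Δ i d).degree < n := by
  have hlt : ∀ p : ℚ[X], p ∈ degreeLT ℚ n ↔ p.degree < n := fun p => mem_degreeLT
  rw [← hlt]
  refine Submodule.sum_mem _ fun A _ => Submodule.sum_mem _ fun G _ => ?_
  rw [← smul_eq_C_mul]
  refine Submodule.smul_mem _ _ ((hlt _).mpr (degree_negCountPoly_lt ?_))
  simpa using G.card_le_univ

lemma hilbertSeries_mul_one_sub_X_pow (i : ℕ) {j : ℤ} (hj : j < 0) :
    hilbertSeries K Δ i j * (1 - PowerSeries.X) ^ m =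
      ((bernsteinSum m fun d => (hilbertCoeff K Δ i d).eval (j : ℚ) : ℚ[X]) : PowerSeries ℚ) := by
  obtain ⟨l, rfl⟩ : ∃ l : ℕ, j = -((l + 1 : ℕ) : ℤ) := ⟨(-j - 1).toNat, by omega⟩
  have h1 : hilbertSeries K Δ i (-((l + 1 : ℕ) : ℤ)) = ∑ A : Finset (Fin m),
      ∑ G : Finset (Fin n), PowerSeries.C ((signDim K Δ i A G : ℚ) * supportCount G (l + 1)) *
        geomTail ^ A.card := by
    ext k
    rw [hilbertSeries, PowerSeries.coeff_mk, finrank_cohomologyPiece]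
    simp only [map_sum, PowerSeries.coeff_C_mul, coeff_geomTail_pow_card]
    push_cast
    refine Finset.sum_congr rfl fun A _ => Finset.sum_congr rfl fun G _ => ?_
    ring
  have h2 : ∀ d, (hilbertCoeff K Δ i d).eval (((-((l + 1 : ℕ) : ℤ) : ℤ)) : ℚ) =
      ∑ A ∈ Finset.powersetCard d (Finset.univ : Finset (Fin m)), ∑ G : Finset (Fin n),
        (signDim K Δ i A G : ℚ) * supportCount G (l + 1) := by
    intro d
    rw [hilbertCoeff, eval_finsetSum]
    refine Finset.sum_congr rfl fun A _ => ?_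
    rw [eval_finsetSum]
    refine Finset.sum_congr rfl fun G _ => ?_
    rw [eval_mul, eval_C, Int.cast_neg, Int.cast_natCast, eval_negCountPoly_card]
  have h3 : ((bernsteinSum m fun d => (hilbertCoeff K Δ i d).eval
      (((-((l + 1 : ℕ) : ℤ) : ℤ)) : ℚ) : ℚ[X]) : PowerSeries ℚ) =
      ∑ d ∈ Finset.range (m + 1), PowerSeries.C ((hilbertCoeff K Δ i d).eval
        (((-((l + 1 : ℕ) : ℤ) : ℤ)) : ℚ)) *
        (PowerSeries.X ^ d * (1 - PowerSeries.X) ^ (m - d)) := by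
    rw [bernsteinSum, ← Polynomial.coeToPowerSeries.ringHom_apply, map_sum]
    refine Finset.sum_congr rfl fun d _ => ?_
    simp
  rw [h3, h1, ← Finset.sum_fiberwise_of_maps_to (s := Finset.univ)
    (t := Finset.range (m + 1)) (g := fun A : Finset (Fin m) => A.card), Finset.sum_mul]
  · refine Finset.sum_congr rfl fun d hd => ?_
    have hd' : d ≤ m := Nat.lt_succ_iff.mp (Finset.mem_range.mp hd)
    rw [← geomTail_pow_mul_one_sub_X_pow hd', h2, map_sum, Finset.sum_mul, Finset.sum_mul]
    refine Finset.sum_congr (by ext; simp [Finset.mem_powersetCard]) fun A hA => ?_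
    rw [(Finset.mem_powersetCard.mp hA).2, map_sum, Finset.sum_mul, Finset.sum_mul]
    exact Finset.sum_congr rfl fun G _ => mul_assoc _ _ _
  · intro A _
    rw [Finset.mem_range]
    have := A.card_le_univ
    rw [Fintype.card_fin] at this
    omega

/-- There is a nonzero component of the local cohomology in the multidegrees with `d` positive
entries in the `x`-part, and nonzero `y`-part. -/
def HasComponent (i d : ℕ) : Prop :=
  ∃ (A : Finset (Fin m)) (G : Finset (Fin n)), A.card = d ∧ G.Nonempty ∧ signDim K Δ i A G ≠ 0

lemma hilbertCoeff_eq_zero {i d : ℕ} (h : ¬ HasComponent K Δ i d) : hilbertCoeff K Δ i d = 0 := by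
  refine Finset.sum_eq_zero fun A hA => Finset.sum_eq_zero fun G _ => ?_
  rcases G.eq_empty_or_nonempty with rfl | hG
  · rw [Finset.card_empty, negCountPoly, mul_zero]
  · have : signDim K Δ i A G = 0 := by
      by_contra h'
      exact h ⟨A, G, (Finset.mem_powersetCard.mp hA).2, hG, h'⟩
    rw [this, Nat.cast_zero, C_0, zero_mul]

lemma eval_hilbertCoeff_ne_zero {i d : ℕ} (h : HasComponent K Δ i d) {j : ℤ}
    (hj : j ≤ -(n + 1 : ℤ)) : (hilbertCoeff K Δ i d).eval (j : ℚ) ≠ 0 := by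
  obtain ⟨l, rfl⟩ : ∃ l : ℕ, j = -((l + 1 : ℕ) : ℤ) := ⟨(-j - 1).toNat, by omega⟩
  obtain ⟨A, G, hA, hG, h0⟩ := h
  have hcast : (((-((l + 1 : ℕ) : ℤ) : ℤ)) : ℚ) = -((l + 1 : ℕ) : ℚ) := by
    rw [Int.cast_neg, Int.cast_natCast]
  have hnn : ∀ (A : Finset (Fin m)) (G : Finset (Fin n)),
      0 ≤ (C (signDim K Δ i A G : ℚ) * negCountPoly G.card).eval (-((l + 1 : ℕ) : ℚ)) := by
    intro A G
    rw [eval_mul, eval_C, eval_negCountPoly_card]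
    positivity
  rw [hcast, hilbertCoeff, eval_finsetSum]
  refine ne_of_gt (Finset.sum_pos' (fun A _ => ?_) ⟨A, ?_, ?_⟩)
  · rw [eval_finsetSum]
    exact Finset.sum_nonneg fun G _ => hnn A G
  · exact Finset.mem_powersetCard.mpr ⟨Finset.subset_univ A, hA⟩
  · rw [eval_finsetSum]
    refine Finset.sum_pos' (fun G _ => hnn A G) ⟨G, Finset.mem_univ G, ?_⟩
    obtain ⟨g, hg⟩ : ∃ g, G.card = g + 1 := Nat.exists_eq_succ_of_ne_zero hG.card_ne_zero
    rw [eval_mul, eval_C, hg, eval_negCountPoly]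
    have hle := G.card_le_univ
    rw [Fintype.card_fin] at hle
    have hpos : 0 < l.choose g := Nat.choose_pos (by omega)
    have hpos' : 0 < signDim K Δ i A G := Nat.pos_of_ne_zero h0
    positivity

lemma hilbertCoeff_ne_zero {i d : ℕ} (h : HasComponent K Δ i d) : hilbertCoeff K Δ i d ≠ 0 :=
  fun h0 => eval_hilbertCoeff_ne_zero K Δ h le_rfl (by rw [h0, eval_zero])

end Dimension

/-! ### The ring of elements of `y`-degree zero -/

section RingZero

variable (K : Type*) [Field K] {m n : ℕ} (Δ : PreAbstractSimplicialComplex (Fin m ⊕ Fin n))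

/-- An exponent vector in the variables `x`, as an exponent vector in all the variables. -/
def xExp (n : ℕ) {m : ℕ} (a : Fin m →₀ ℕ) : Fin m ⊕ Fin n →₀ ℕ := a.mapDomain Sum.inl

@[simp] lemma xExp_inl (a : Fin m →₀ ℕ) (v : Fin m) : xExp n a (Sum.inl v) = a v :=
  Finsupp.mapDomain_apply Sum.inl_injective a v

@[simp] lemma xExp_inr (a : Fin m →₀ ℕ) (v : Fin n) : xExp n a (Sum.inr v) = 0 :=
  Finsupp.mapDomain_of_notMem_range a _ (by simp)

lemma xExp_add (a a' : Fin m →₀ ℕ) : xExp n (a + a') = xExp n a + xExp n a' :=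
  Finsupp.mapDomain_add

lemma xExp_injective : Function.Injective (xExp n : (Fin m →₀ ℕ) → _) :=
  Finsupp.mapDomain_injective Sum.inl_injective

lemma yTotal_xExp (a : Fin m →₀ ℕ) : yTotal (expDeg (xExp n a)) = 0 := by simp [yTotal]

lemma expDeg_injective {σ : Type*} : Function.Injective (expDeg : (σ →₀ ℕ) → σ → ℤ) :=
  fun c c' h => Finsupp.ext fun v => by simpa using congrFun h v

lemma localDegree_add_xExp (a a' : Fin m →₀ ℕ) (b : Fin n →₀ ℕ) :
    localDegree a b + expDeg (xExp n a') = localDegree (a + a') b := by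
  funext v
  rcases v with v | v <;> simp [localDegree]

lemma ringMono_xExp_mem (a : Fin m →₀ ℕ) : ringMono K Δ (xExp n a) ∈ ringZero K Δ := by
  refine ⟨_, ?_, rfl⟩
  change MvPolynomial.IsWeightedHomogeneous (yDegree m n) _ 0
  refine MvPolynomial.isWeightedHomogeneous_monomial _ _ _ ?_
  have := weight_yDegree (xExp n a)
  rw [yTotal_xExp] at this
  exact_mod_cast this

/-- The monomial `x^a` as an element of `R_0`. -/
def xMono (a : Fin m →₀ ℕ) : ringZero K Δ := ⟨ringMono K Δ (xExp n a), ringMono_xExp_mem K Δ a⟩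

lemma xMono_add (a a' : Fin m →₀ ℕ) : xMono K Δ (a + a') = xMono K Δ a * xMono K Δ a' :=
  Subtype.ext (by
    change ringMono K Δ (xExp n (a + a')) = ringMono K Δ (xExp n a) * ringMono K Δ (xExp n a')
    rw [xExp_add, ringMono_add])

lemma xMono_zero : xMono K Δ 0 = 1 :=
  Subtype.ext (by
    change ringMono K Δ (xExp n 0) = 1
    rw [xExp, Finsupp.mapDomain_zero, ringMono_zero])

/-- The map from the polynomial ring in the variables `x` onto `R_0`. -/
def toRingZero : MvPolynomial (Fin m) K →ₐ[K] ringZero K Δ :=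
  MvPolynomial.aeval fun v => xMono K Δ (Finsupp.single v 1)

lemma toRingZero_monomial (a : Fin m →₀ ℕ) (r : K) :
    toRingZero K Δ (MvPolynomial.monomial a r) = r • xMono K Δ a := by
  rw [← mul_one r, ← smul_eq_mul, ← MvPolynomial.smul_monomial, map_smul, smul_eq_mul, mul_one]
  congr 1
  induction a using Finsupp.induction_linear with
  | zero => rw [xMono_zero]; exact map_one _
  | add a a' h h' => rw [xMono_add, ← h, ← h', ← map_mul, MvPolynomial.monomial_mul, one_mul]
  | single v k =>
    rw [← MvPolynomial.X_pow_eq_monomial, map_pow, toRingZero, MvPolynomial.aeval_X]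
    induction k with
    | zero => rw [pow_zero, Finsupp.single_zero, xMono_zero]
    | succ k ih => rw [pow_succ, ih, ← xMono_add, ← Finsupp.single_add]

lemma toRingZero_surjective : Function.Surjective (toRingZero K Δ) := by
  rintro ⟨_, f, hf, rfl⟩
  have h1 : ∀ c ∈ f.support, ∃ a : Fin m →₀ ℕ, c = xExp n a := by
    intro c hc
    have hw : Finsupp.weight (yDegree m n) c = 0 := hf (MvPolynomial.mem_support_iff.mp hc)
    have h2 := weight_yDegree c
    rw [hw, yTotal] at h2
    refine ⟨Finsupp.equivFunOnFinite.symm fun v => c (Sum.inl v), Finsupp.ext fun v => ?_⟩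
    rcases v with v | v
    · simp
    · have h3 := (Finset.sum_eq_zero_iff_of_nonneg (fun v _ => by simp)).mp h2.symm v
        (Finset.mem_univ v)
      simpa using h3
  choose! g hg using h1
  refine ⟨∑ c ∈ f.support, MvPolynomial.monomial (g c) (f.coeff c), ?_⟩
  rw [map_sum]
  refine Subtype.ext ?_
  rw [AddSubmonoidClass.coe_finsetSum]
  change _ = Ideal.Quotient.mkₐ K (stanleyReisnerIdeal K Δ) f
  conv_rhs => rw [f.as_sum, map_sum]
  refine Finset.sum_congr rfl fun c hc => ?_
  rw [toRingZero_monomial]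
  change f.coeff c • ringMono K Δ (xExp n (g c)) = _
  rw [← hg c hc, ringMono, ← map_smul, MvPolynomial.smul_monomial, smul_eq_mul, mul_one]

lemma toRingZero_smul {i : ℕ} (f : MvPolynomial (Fin m) K) (ξ : LocalCohomology K Δ i) :
    toRingZero K Δ f • ξ =
      ∑ a ∈ f.support, f.coeff a • ringMono K Δ (xExp n a) • ξ := by
  conv_lhs => rw [f.as_sum, map_sum, Finset.sum_smul]
  refine Finset.sum_congr rfl fun a _ => ?_
  rw [toRingZero_monomial, smul_assoc]
  rfl

/-- The map of polynomial rings that keeps the variables in `A` and sends the others to `0`. -/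
def killVars (A : Finset (Fin m)) : MvPolynomial (Fin m) K →ₐ[K] MvPolynomial A K :=
  MvPolynomial.aeval fun v => if h : v ∈ A then MvPolynomial.X ⟨v, h⟩ else 0

lemma killVars_surjective (A : Finset (Fin m)) : Function.Surjective (killVars K A) := by
  intro f
  refine ⟨MvPolynomial.rename Subtype.val f, ?_⟩
  have : (killVars K A).comp (MvPolynomial.rename Subtype.val) = AlgHom.id K _ := by
    ext v
    simp [killVars]
  exact DFunLike.congr_fun this f

lemma killVars_monomial_eq_zero {A : Finset (Fin m)} {a : Fin m →₀ ℕ} (h : ¬ a.support ⊆ A)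
    (r : K) : killVars K A (MvPolynomial.monomial a r) = 0 := by
  obtain ⟨v, hv, hvA⟩ := Finset.not_subset.mp h
  rw [killVars, MvPolynomial.aeval_monomial, Finsupp.prod, Finset.prod_eq_zero hv, mul_zero]
  rw [dif_neg hvA, zero_pow (Finsupp.mem_support_iff.mp hv)]

end RingZero

/-! ### The components of fixed `y`-degree -/

section Degree

variable (K : Type*) [Field K] {m n : ℕ} (Δ : PreAbstractSimplicialComplex (Fin m ⊕ Fin n))

lemma cohomologyProj_ringMono_smul {i : ℕ} (c : Fin m ⊕ Fin n →₀ ℕ) (e : Fin m ⊕ Fin n → ℤ)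
    (ξ : LocalCohomology K Δ i) :
    cohomologyProj K Δ i e (ringMono K Δ c • ξ) =
      ringMono K Δ c • cohomologyProj K Δ i (e - expDeg c) ξ := by
  rw [ringMono_smul_cohomologyProj, sub_add_cancel]

lemma mem_cohomologyDegree_iff {i : ℕ} {j : ℤ} {ξ : LocalCohomology K Δ i} :
    ξ ∈ cohomologyDegree K Δ i j ↔ ∀ e, cohomologyProj K Δ i e ξ ≠ 0 → yTotal e = j := by
  constructor
  · intro hξ
    induction hξ using Submodule.span_induction with
    | mem x hx =>
      obtain ⟨k, hk⟩ := Set.mem_iUnion.mp hx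
      exact fun e he => ((mem_cohomologyPiece_iff K Δ).mp hk e he).2
    | zero => exact fun e he => absurd (map_zero _) he
    | add x y _ _ hx hy =>
      intro e he
      by_cases hxe : cohomologyProj K Δ i e x = 0
      · exact hy e fun h => he (by rw [map_add, hxe, h, add_zero])
      · exact hx e hxe
    | smul r x _ hx =>
      intro e he
      obtain ⟨f, rfl⟩ := toRingZero_surjective K Δ r
      rw [toRingZero_smul, map_sum] at he
      obtain ⟨a, -, ha⟩ := Finset.exists_ne_zero_of_sum_ne_zero he
      rw [map_smul, cohomologyProj_ringMono_smul] at ha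
      have h1 : cohomologyProj K Δ i (e - expDeg (xExp n a)) x ≠ 0 := fun h =>
        ha (by rw [h, smul_zero, smul_zero])
      have h2 := hx _ h1
      rw [← h2]
      conv_lhs => rw [← sub_add_cancel e (expDeg (xExp n a)), yTotal_add, yTotal_xExp, add_zero]
  · intro h
    obtain ⟨s, -, hs⟩ := exists_eq_sum_cohomologyProj K Δ ξ
    rw [hs]
    refine Submodule.sum_mem _ fun e _ => ?_
    by_cases he : cohomologyProj K Δ i e ξ = 0
    · rw [he]; exact Submodule.zero_mem _
    · refine Submodule.subset_span (Set.mem_iUnion.mpr ⟨xTotal e,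
        (mem_cohomologyPiece_iff K Δ).mpr fun d hd => ?_⟩)
      have hde : d = e := by
        by_contra hne
        exact hd (cohomologyProj_cohomologyProj_of_ne K Δ hne ξ)
      rw [hde]
      exact ⟨rfl, h e he⟩

/-- The module is generated by its components in the multidegrees with `x`-part in `{0, 1}`: the
others arise from these by multiplication with monomials. -/
lemma finite_cohomologyDegree (i : ℕ) (j : ℤ) :
    Module.Finite (ringZero K Δ) (cohomologyDegree K Δ i j) := by
  classical
  have hfg : ∀ e, ∃ s : Finset (LocalCohomology K Δ i),
      Submodule.span K (s : Set (LocalCohomology K Δ i)) = cohomologyComponent K Δ i e := fun e =>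
    Module.Finite.iff_fg.mp (finite_cohomologyComponent K Δ i e)
  choose S hS using hfg
  let T : Finset (Fin m ⊕ Fin n → ℤ) :=
    (Finset.univ ×ˢ Finset.finsuppAntidiag Finset.univ (-j).toNat).image
      fun p : Finset (Fin m) × (Fin n →₀ ℕ) => localDegree (indicatorVec p.1) p.2
  rw [Module.Finite.iff_fg]
  by_cases hj : 0 < j
  · have : cohomologyDegree K Δ i j = ⊥ := by
      refine (Submodule.eq_bot_iff _).mpr fun ξ hξ =>
        eq_zero_of_cohomologyProj_eq_zero K Δ fun e => ?_
      by_contra he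
      have h1 := (mem_cohomologyDegree_iff K Δ).mp hξ e he
      obtain ⟨a, b, rfl⟩ := exists_eq_localDegree K Δ he
      rw [yTotal_localDegree] at h1
      omega
    rw [this]
    exact Submodule.fg_bot
  · refine ⟨T.biUnion S, le_antisymm ?_ fun ξ hξ => ?_⟩
    · refine Submodule.span_le.mpr fun ξ hξ => ?_
      obtain ⟨e, he, hξ⟩ := Finset.mem_biUnion.mp hξ
      obtain ⟨⟨A, b⟩, hb, rfl⟩ := Finset.mem_image.mp he
      have hξ' : ξ ∈ cohomologyComponent K Δ i (localDegree (indicatorVec A) b) := by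
        rw [← hS]
        exact Submodule.subset_span hξ
      refine (mem_cohomologyDegree_iff K Δ).mpr fun d hd => ?_
      have hd' : d = localDegree (indicatorVec A) b := by
        by_contra hne
        refine hd ?_
        rw [← (mem_cohomologyComponent K Δ).mp hξ']
        exact cohomologyProj_cohomologyProj_of_ne K Δ hne ξ
      have hb' : ∑ v, b v = (-j).toNat := by
        have := (Finset.mem_product.mp hb).2
        simpa using this
      rw [hd', yTotal_localDegree, hb']
      omega
    · obtain ⟨s, -, hs⟩ := exists_eq_sum_cohomologyProj K Δ ξ
      rw [hs]
      refine Submodule.sum_mem _ fun e _ => ?_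
      by_cases he : cohomologyProj K Δ i e ξ = 0
      · rw [he]; exact Submodule.zero_mem _
      · have h1 := (mem_cohomologyDegree_iff K Δ).mp hξ e he
        obtain ⟨a, b, rfl⟩ := exists_eq_localDegree K Δ he
        rw [yTotal_localDegree] at h1
        have hle : indicatorVec a.support ≤ a := fun v => by
          rw [indicatorVec_apply]
          split_ifs with hv
          · exact Nat.one_le_iff_ne_zero.mpr (Finsupp.mem_support_iff.mp hv)
          · exact Nat.zero_le _
        -- The component of degree `(a, -b)` is `x ^ (a - 1_A)` times that of degree `(1_A, -b)`.
        have hdeg : localDegree (indicatorVec a.support) b +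
            expDeg (xExp n (a - indicatorVec a.support)) = localDegree a b := by
          rw [localDegree_add_xExp, add_tsub_cancel_of_le hle]
        have hsame : SameSign (localDegree (indicatorVec a.support) b) (localDegree a b) :=
          sameSign_localDegree (support_indicatorVec _) rfl
        have hsame' : SameSign (localDegree (indicatorVec a.support) b)
            (localDegree (indicatorVec a.support) b +
              expDeg (xExp n (a - indicatorVec a.support))) := hdeg ▸ hsame
        have h3 : cohomologyProj K Δ i (localDegree a b) ξ =
            xMono K Δ (a - indicatorVec a.support) • cohomologyShift K Δ i hsame.symm ξ := by
          have h4 := ringMono_smul_cohomologyProj_of_sameSign K Δ hsame'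
            (cohomologyShift K Δ i hsame.symm ξ)
          rw [cohomologyProj_cohomologyShift] at h4
          refine Eq.trans ?_ h4.symm
          have h5 : ∀ (d : Fin m ⊕ Fin n → ℤ) (hd : d = localDegree a b)
              (hsd : SameSign (localDegree (indicatorVec a.support) b) d),
              cohomologyProj K Δ i (localDegree a b) ξ =
                cohomologyShift K Δ i hsd (cohomologyShift K Δ i hsame.symm ξ) := by
            rintro d rfl hsd
            rw [cohomologyShift_comp]
            rfl
          exact h5 _ hdeg hsame'
        rw [h3]
        refine Submodule.smul_mem _ _ ?_
        have h6 : cohomologyShift K Δ i hsame.symm ξ ∈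
            Submodule.span K (S (localDegree (indicatorVec a.support) b) :
              Set (LocalCohomology K Δ i)) := by
          rw [hS]
          exact ⟨_, cohomologyProj_cohomologyShift K Δ hsame.symm ξ⟩
        refine Submodule.span_mono ?_ (Submodule.span_subset_span K (ringZero K Δ) _ h6)
        refine Finset.coe_subset.mpr (Finset.subset_biUnion_of_mem S (Finset.mem_image.mpr
          ⟨(a.support, b), Finset.mem_product.mpr ⟨Finset.mem_univ _, ?_⟩, rfl⟩))
        simp only [Finset.mem_finsuppAntidiag, Finset.subset_univ, and_true]
        change ∑ v, b v = _
        omega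

lemma signDim_ne_zero_of_cohomologyProj_ne_zero {i : ℕ} {a : Fin m →₀ ℕ} {b : Fin n →₀ ℕ}
    {ξ : LocalCohomology K Δ i} (h : cohomologyProj K Δ i (localDegree a b) ξ ≠ 0) :
    signDim K Δ i a.support b.support ≠ 0 := by
  rw [← finrank_cohomologyComponent]
  intro h0
  have h1 := Submodule.finrank_eq_zero.mp h0
  exact h ((Submodule.eq_bot_iff _).mp h1 _ ⟨ξ, rfl⟩)

lemma hasComponent_of_cohomologyProj_ne_zero {i : ℕ} {j : ℤ} (hj : j < 0)
    {ξ : LocalCohomology K Δ i} (hξ : ξ ∈ cohomologyDegree K Δ i j) {a : Fin m →₀ ℕ}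
    {b : Fin n →₀ ℕ} (h : cohomologyProj K Δ i (localDegree a b) ξ ≠ 0) :
    HasComponent K Δ i a.support.card := by
  refine ⟨a.support, b.support, rfl, ?_, signDim_ne_zero_of_cohomologyProj_ne_zero K Δ h⟩
  have h1 := (mem_cohomologyDegree_iff K Δ).mp hξ _ h
  rw [yTotal_localDegree] at h1
  rw [Finset.nonempty_iff_ne_empty, Ne, Finsupp.support_eq_empty]
  rintro rfl
  simp at h1
  omega

lemma cohomologyDegree_eq_bot {i : ℕ} {j : ℤ} (hj : j < 0) (h : ∀ d, ¬ HasComponent K Δ i d) :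
    cohomologyDegree K Δ i j = ⊥ := by
  refine (Submodule.eq_bot_iff _).mpr fun ξ hξ => eq_zero_of_cohomologyProj_eq_zero K Δ fun e => ?_
  by_contra he
  obtain ⟨a, b, rfl⟩ := exists_eq_localDegree K Δ he
  exact h _ (hasComponent_of_cohomologyProj_ne_zero K Δ hj hξ he)

/-! ### The Krull dimension -/

/-- The dimension is at least the number of positive entries in the `x`-part of a multidegree with
nonzero component: an element of that component is not annihilated by any nonzero polynomial in the
variables at these entries. -/
lemma le_supportDim_cohomologyDegree {i d : ℕ} {j : ℤ} (hj : j ≤ -(n + 1 : ℤ))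
    (h : HasComponent K Δ i d) :
    (d : WithBot ℕ∞) ≤ Module.supportDim (ringZero K Δ) (cohomologyDegree K Δ i j) := by
  classical
  have := finite_cohomologyDegree K Δ i j
  obtain ⟨A, G, rfl, ⟨g, hg⟩, h0⟩ := h
  have hG : G.card ≤ n := by simpa using G.card_le_univ
  obtain ⟨b, hb, hsum⟩ : ∃ b : Fin n →₀ ℕ, b.support = G ∧ -((∑ v, b v : ℕ) : ℤ) = j := by
    refine ⟨indicatorVec G + Finsupp.single g ((-j).toNat - G.card), ?_, ?_⟩
    · ext v
      by_cases hv : v = g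
      · subst hv; simp [indicatorVec_apply, hg]
      · simp [indicatorVec_apply, Ne.symm hv]
    · have : ∑ v, (indicatorVec G + Finsupp.single g ((-j).toNat - G.card)) v = (-j).toNat := by
        simp only [Finsupp.add_apply, Finset.sum_add_distrib, indicatorVec_apply,
          Finsupp.single_apply, Finset.sum_ite_eq, Finset.mem_univ, if_true, Finset.sum_ite_mem,
          Finset.univ_inter, Finset.sum_const, smul_eq_mul, mul_one]
        omega
      rw [this]
      omega
  obtain ⟨ζ, hζ, hζ0⟩ : ∃ ζ,
      cohomologyProj K Δ i (localDegree (indicatorVec A) b) ζ = ζ ∧ ζ ≠ 0 := by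
    have h1 : Module.finrank K
        (cohomologyComponent K Δ i (localDegree (indicatorVec A) b)) ≠ 0 := by
      rwa [finrank_cohomologyComponent, support_indicatorVec, hb]
    rw [Ne, Submodule.finrank_eq_zero, ← Ne, Submodule.ne_bot_iff] at h1
    obtain ⟨ζ, hζ, hζ0⟩ := h1
    exact ⟨ζ, (mem_cohomologyComponent K Δ).mp hζ, hζ0⟩
  have hζM : ζ ∈ cohomologyDegree K Δ i j := by
    refine (mem_cohomologyDegree_iff K Δ).mpr fun e he => ?_
    have : e = localDegree (indicatorVec A) b := by
      by_contra hne
      refine he ?_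
      rw [← hζ]
      exact cohomologyProj_cohomologyProj_of_ne K Δ hne ζ
    rw [this, yTotal_localDegree, hsum]
  have hne : ∀ a : Fin m →₀ ℕ, a.support ⊆ A → ringMono K Δ (xExp n a) • ζ ≠ 0 := by
    intro a ha hz
    have hsame : SameSign (localDegree (indicatorVec A) b)
        (localDegree (indicatorVec A) b + expDeg (xExp n a)) := by
      rw [localDegree_add_xExp]
      refine sameSign_localDegree ?_ rfl
      ext v
      have := @ha v
      simp only [Finsupp.mem_support_iff, Finsupp.add_apply, indicatorVec_apply] at this ⊢
      split_ifs <;> simp_all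
    have h1 := ringMono_smul_cohomologyProj_of_sameSign K Δ hsame ζ
    rw [hζ, hz] at h1
    have h2 := cohomologyShift_comp K Δ hsame hsame.symm ζ
    rw [← h1, map_zero] at h2
    exact hζ0 (hζ.symm.trans h2.symm)
  set M := cohomologyDegree K Δ i j with hM
  let π : MvPolynomial (Fin m) K →+* ringZero K Δ ⧸ Module.annihilator (ringZero K Δ) M :=
    (Ideal.Quotient.mk _).comp (toRingZero K Δ).toRingHom
  have hπ : Function.Surjective π :=
    Ideal.Quotient.mk_surjective.comp (toRingZero_surjective K Δ)
  have hker : RingHom.ker π ≤ RingHom.ker (killVars K A).toRingHom := by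
    intro f hf
    have h1 : toRingZero K Δ f ∈ Module.annihilator (ringZero K Δ) M :=
      Ideal.Quotient.eq_zero_iff_mem.mp hf
    have h2 : toRingZero K Δ f • ζ = 0 :=
      congrArg Subtype.val (Module.mem_annihilator.mp h1 ⟨ζ, hζM⟩)
    rw [toRingZero_smul] at h2
    have h3 : ∀ a ∈ f.support, ¬ a.support ⊆ A := by
      intro a ha haA
      have h4 := congrArg (cohomologyProj K Δ i
        (localDegree (indicatorVec A) b + expDeg (xExp n a))) h2
      rw [map_zero, map_sum, Finset.sum_eq_single a] at h4
      · rw [map_smul, ← ringMono_smul_cohomologyProj, hζ] at h4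
        exact (smul_ne_zero (MvPolynomial.mem_support_iff.mp ha) (hne a haA)) h4
      · intro a' _ haa
        rw [map_smul, ← hζ, ringMono_smul_cohomologyProj, cohomologyProj_cohomologyProj_of_ne,
          smul_zero]
        exact fun h => haa (xExp_injective (expDeg_injective (add_left_cancel h))).symm
      · exact fun h => absurd ha h
    change killVars K A f = 0
    rw [f.as_sum, map_sum]
    exact Finset.sum_eq_zero fun a ha => killVars_monomial_eq_zero K (h3 a ha) _
  rw [Module.supportDim_eq_ringKrullDim_quotient_annihilator]
  have h5 : ringKrullDim (MvPolynomial A K) = (A.card : WithBot ℕ∞) := by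
    rw [MvPolynomial.ringKrullDim_of_isNoetherianRing, ringKrullDim_eq_zero_of_field, zero_add,
      Nat.card_eq_fintype_card, Fintype.card_coe]
  rw [← h5]
  refine ringKrullDim_le_of_surjective
    (RingHom.liftOfSurjective π hπ ⟨(killVars K A).toRingHom, hker⟩) ?_
  refine Function.Surjective.of_comp (g := π) ?_
  rw [← RingHom.coe_comp, RingHom.liftOfRightInverse_comp]
  exact killVars_surjective K A

/-- If `B` is the set of variables `x v` not contained in the prime `p`, then the dimension of the
quotient by `p` is at most the cardinality of `B`. -/
lemma ringKrullDim_quotient_le_card (p : Ideal (ringZero K Δ)) (B : Finset (Fin m))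
    (hB : ∀ v, v ∉ B → xMono K Δ (Finsupp.single v 1) ∈ p) :
    ringKrullDim (ringZero K Δ ⧸ p) ≤ (B.card : WithBot ℕ∞) := by
  let ψ : MvPolynomial B K →ₐ[K] ringZero K Δ ⧸ p :=
    MvPolynomial.aeval fun v => Ideal.Quotient.mkₐ K p (xMono K Δ (Finsupp.single v.1 1))
  have h1 : ψ.comp (killVars K B) = (Ideal.Quotient.mkₐ K p).comp (toRingZero K Δ) := by
    refine MvPolynomial.algHom_ext fun v => ?_
    rw [AlgHom.comp_apply, AlgHom.comp_apply, killVars, MvPolynomial.aeval_X, toRingZero,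
      MvPolynomial.aeval_X]
    split_ifs with hv
    · exact MvPolynomial.aeval_X _ _
    · rw [map_zero]
      exact (Ideal.Quotient.eq_zero_iff_mem.mpr (hB v hv)).symm
  have h2 : Function.Surjective ψ := by
    refine Function.Surjective.of_comp (g := killVars K B) ?_
    rw [← AlgHom.coe_comp, h1]
    exact Ideal.Quotient.mk_surjective.comp (toRingZero_surjective K Δ)
  refine (ringKrullDim_le_of_surjective ψ.toRingHom h2).trans_eq ?_
  rw [MvPolynomial.ringKrullDim_of_isNoetherianRing, ringKrullDim_eq_zero_of_field, zero_add,
    Nat.card_eq_fintype_card, Fintype.card_coe]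

/-- The dimension is at most the largest number of positive entries in the `x`-part of a multidegree
with nonzero component: if `B` is the set of variables outside a prime in the support, then the
product of the variables in `B` does not annihilate the module. -/
lemma supportDim_cohomologyDegree_le {i D : ℕ} {j : ℤ} (hj : j < 0)
    (hD : ∀ d, HasComponent K Δ i d → d ≤ D) :
    Module.supportDim (ringZero K Δ) (cohomologyDegree K Δ i j) ≤ (D : WithBot ℕ∞) := by
  classical
  have := finite_cohomologyDegree K Δ i j
  set M := cohomologyDegree K Δ i j with hM
  rw [Module.supportDim, Order.krullDim_eq_iSup_coheight]
  refine iSup_le fun p => ?_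
  rw [Order.coheight_eq_krullDim_Ici]
  let B : Finset (Fin m) :=
    Finset.univ.filter fun v => xMono K Δ (Finsupp.single v 1) ∉ p.1.asIdeal
  have hBcard : B.card ≤ D := by
    have h1 : xMono K Δ (indicatorVec B) ∉ p.1.asIdeal := by
      have h2 : indicatorVec B = ∑ v ∈ B, Finsupp.single v 1 := by
        ext w
        simp [indicatorVec_apply, Finsupp.single_apply, Finsupp.finsetSum_apply]
      have h3 : xMono K Δ (∑ v ∈ B, Finsupp.single v 1) =
          ∏ v ∈ B, xMono K Δ (Finsupp.single v 1) := by
        induction B using Finset.induction_on with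
        | empty => rw [Finset.sum_empty, Finset.prod_empty, xMono_zero]
        | insert v s hv ih => rw [Finset.sum_insert hv, Finset.prod_insert hv, xMono_add, ih]
      rw [h2, h3, Ideal.IsPrime.prod_mem_iff]
      rintro ⟨v, hv, hvp⟩
      exact (Finset.mem_filter.mp hv).2 hvp
    have h4 : xMono K Δ (indicatorVec B) ∉ Module.annihilator (ringZero K Δ) M := fun h =>
      h1 (Module.mem_support_iff_of_finite.mp p.2 h)
    rw [Module.mem_annihilator] at h4
    push Not at h4
    obtain ⟨⟨ξ, hξ⟩, h5⟩ := h4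
    have h6 : ringMono K Δ (xExp n (indicatorVec B)) • ξ ≠ 0 := fun h => h5 (Subtype.ext h)
    obtain ⟨e, he⟩ : ∃ e, cohomologyProj K Δ i e
        (ringMono K Δ (xExp n (indicatorVec B)) • ξ) ≠ 0 := by
      by_contra! h
      exact h6 (eq_zero_of_cohomologyProj_eq_zero K Δ h)
    rw [cohomologyProj_ringMono_smul] at he
    have h7 : cohomologyProj K Δ i (e - expDeg (xExp n (indicatorVec B))) ξ ≠ 0 := fun h =>
      he (by rw [h, smul_zero])
    obtain ⟨a, b, hab⟩ := exists_eq_localDegree K Δ h7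
    rw [hab, ringMono_smul_cohomologyProj, localDegree_add_xExp] at he
    have h8 : xMono K Δ (indicatorVec B) • ξ ∈ M := Submodule.smul_mem _ _ hξ
    refine le_trans (Finset.card_le_card fun v hv => ?_)
      (hD _ (hasComponent_of_cohomologyProj_ne_zero K Δ hj h8 he))
    rw [Finsupp.mem_support_iff, Finsupp.add_apply, indicatorVec_apply, if_pos hv]
    omega
  refine le_trans ?_ ((ringKrullDim_quotient_le_card K Δ p.1.asIdeal B fun v hv => ?_).trans
    (by exact_mod_cast hBcard))
  · rw [ringKrullDim_quotient]
    refine Order.krullDim_le_of_strictMono (fun q => ⟨q.1.1, ?_⟩) fun q q' h => h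
    exact q.2
  · by_contra h
    exact hv (Finset.mem_filter.mpr ⟨Finset.mem_univ v, h⟩)

end Degree

end

end MonomialTame

open MonomialTame in
theorem mainTheorem5 (K : Type*) [Field K] (m n : ℕ)
    (Δ : PreAbstractSimplicialComplex (Fin m ⊕ Fin n)) (i : ℕ) :
    (∀ j k : ℤ, Module.Finite K (MonomialTame.cohomologyPiece K Δ i k j)) ∧
    (∀ j : ℤ, Module.Finite (MonomialTame.ringZero K Δ) (MonomialTame.cohomologyDegree K Δ i j)) ∧
    ∃ (Q : ℚ[X][X]) (d : WithBot ℕ∞) (j₀ : ℤ),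
      Q.natDegree ≤ m ∧
      (∀ r : ℕ, (Q.coeff r).degree < n) ∧
      (∀ j : ℤ, j < 0 →
        MonomialTame.hilbertSeries K Δ i j * (1 - PowerSeries.X) ^ m =
          (MonomialTame.specialize Q j : PowerSeries ℚ)) ∧
      j₀ < 0 ∧
      (∀ j : ℤ, j ≤ j₀ →
        Module.supportDim (MonomialTame.ringZero K Δ) (MonomialTame.cohomologyDegree K Δ i j) = d) ∧
      (Q = 0 → d = ⊥) ∧
      (Q ≠ 0 →
        Q.rootMultiplicity 1 ≤ m ∧
        d = ((m - Q.rootMultiplicity 1 : ℕ) : WithBot ℕ∞) ∧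
        ∀ j : ℤ, j ≤ j₀ →
          MonomialTame.specialize Q j ≠ 0 ∧
          (MonomialTame.specialize Q j).rootMultiplicity 1 = Q.rootMultiplicity 1) := by
  classical
  refine ⟨fun j k => finite_cohomologyPiece K Δ i k j, finite_cohomologyDegree K Δ i, ?_⟩
  have hspec : ∀ j : ℤ, specialize (bernsteinSum m (hilbertCoeff K Δ i)) j =
      bernsteinSum m fun d => (hilbertCoeff K Δ i d).eval (j : ℚ) := fun j =>
    map_bernsteinSum _ m _
  have hcoeff : ∀ r : ℕ, ((bernsteinSum m (hilbertCoeff K Δ i)).coeff r).degree < n := by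
    intro r
    rw [← mem_degreeLT, bernsteinSum, finsetSum_coeff]
    refine Submodule.sum_mem _ fun d _ => ?_
    have hint : (X ^ d * (1 - X) ^ (m - d) : ℚ[X][X]) =
        (X ^ d * (1 - X) ^ (m - d) : ℚ[X]).map C := by simp
    rw [coeff_C_mul, hint, coeff_map, mul_comm, ← smul_eq_C_mul]
    exact Submodule.smul_mem _ _ (mem_degreeLT.mpr (degree_hilbertCoeff_lt K Δ i d))
  have hhilb : ∀ j : ℤ, j < 0 → hilbertSeries K Δ i j * (1 - PowerSeries.X) ^ m =
      (specialize (bernsteinSum m (hilbertCoeff K Δ i)) j : PowerSeries ℚ) := fun j hj => by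
    rw [hspec, hilbertSeries_mul_one_sub_X_pow K Δ i hj]
  have hle : ∀ d, HasComponent K Δ i d → d ≤ m := by
    rintro d ⟨A, -, rfl, -⟩
    simpa using A.card_le_univ
  by_cases hex : ∃ d, HasComponent K Δ i d
  · -- The dimension is the largest number `D` of positive entries.
    set D := Nat.findGreatest (HasComponent K Δ i) m with hDdef
    obtain ⟨d, hd⟩ := hex
    have hD : HasComponent K Δ i D := Nat.findGreatest_spec (hle d hd) hd
    have hmax : ∀ d, HasComponent K Δ i d → d ≤ D := fun d hd =>
      Nat.le_findGreatest (hle d hd) hd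
    have hQ := rootMultiplicity_bernsteinSum (hle D hD) (hilbertCoeff_ne_zero K Δ hD)
      fun d _ hd => hilbertCoeff_eq_zero K Δ fun h => absurd (hmax d h) hd.not_ge
    refine ⟨bernsteinSum m (hilbertCoeff K Δ i), (D : WithBot ℕ∞), -(n + 1 : ℤ),
      natDegree_bernsteinSum_le _ _, hcoeff, hhilb, by omega, fun j hj => ?_,
      fun h => absurd h hQ.1, fun _ => ⟨?_, ?_, fun j hj => ?_⟩⟩
    · exact le_antisymm (supportDim_cohomologyDegree_le K Δ (by omega) hmax)
        (le_supportDim_cohomologyDegree K Δ hj hD)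
    · rw [hQ.2]
      exact Nat.sub_le _ _
    · rw [hQ.2, Nat.sub_sub_self (hle D hD)]
    · rw [hspec, hQ.2]
      exact rootMultiplicity_bernsteinSum (hle D hD) (eval_hilbertCoeff_ne_zero K Δ hD hj)
        fun d _ hd => by
          rw [hilbertCoeff_eq_zero K Δ fun h => absurd (hmax d h) hd.not_ge, eval_zero]
  · push Not at hex
    have hQ : bernsteinSum m (hilbertCoeff K Δ i) = 0 :=
      bernsteinSum_eq_zero fun d _ => hilbertCoeff_eq_zero K Δ (hex d)
    refine ⟨bernsteinSum m (hilbertCoeff K Δ i), ⊥, -1, natDegree_bernsteinSum_le _ _, hcoeff,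
      hhilb, by omega, fun j hj => ?_, fun _ => rfl, fun h => absurd hQ h⟩
    have : Subsingleton (cohomologyDegree K Δ i j) := by
      rw [cohomologyDegree_eq_bot K Δ (by omega) hex]
      infer_instance
    exact Module.supportDim_eq_bot_of_subsingleton _ _
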